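/- Let $q>1$ be real and $p=1/q$. Put $[n]_q=1+q+\dots+q^{n-1}$, $[n]_q^!=[1]_q\cdots[n]_q$ and $$e_q(x)=\sum_{n\ge0}\frac{x^n}{[n]_q^!},\qquad \theta_p(x)=\sum_{n\in\mathbb Z}p^{n(n-1)/2}x^n .$$ Let $\hat{\mathcal E}_q(x)=\sum_{n\ge0}(-1)^n[n]_q^!\,x^{n+1}$ be the $q$-Euler series. Its formal Borel transforms $$\mathcal B_q\hat{\mathcal E}_q(\xi)=\sum_{n\ge0}(-1)^n\xi^n,\qquad B_q\hat{\mathcal E}_q(\xi)=\sum_{n\ge0}\frac{(-1)^n[n]_q^!}{q^{n(n-1)/2}}\,\xi^n$$ converge near $0$ and have analytic continuations $\psi(\xi)=1/(1+\xi)$ to $\mathbb C\setminus\{-1\}$ and $\phi$ to $\mathbb C\setminus\{(p-1)q^n:n\in\mathbb N\}$. (1) For $d\in(-\pi,\pi)$ and $x$ on the Riemann surface of the logarithm with $|\arg x-d|<\pi$, the integrals $$\mathcal E_q^d(x)=\frac{q-1}{\ln q}\int_0^{e^{id}\infty}\frac{\psi(\xi)}{e_q(q\xi/x)}\,d\xi,\qquad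 E_q^d(x)=\frac{q}{\ln q}\int_0^{e^{id}\infty}\frac{\phi(\xi)}{\theta_p(q\xi/x)}\,d\xi$$ converge absolutely. There are functions $\mathcal E_q$ and $E_q$, analytic on the sector $|\arg x|<2\pi$ of the Riemann surface of the logarithm, which continue $\mathcal E_q^d$ and $E_q^d$ respectively for every $d\in(-\pi,\pi)$, and $$\mathcal E_q(x)=E_q(x)\qquad\text{for }|\arg x|<2\pi .$$ (2) Write $\int_{\lambda p^{\mathbb Z}}f(\xi)\,d_p\xi=(1-p)\lambda\sum_{n\in\mathbb Z}f(p^n\lambda)p^n$ for the Jackson integral. For every $\lambda\in\mathbb C^*$ with $\lambda\notin-(1-p)q^{\mathbb Z}$ and every $x\in\mathbb C^*$ with $x\notin-\lambda q^{\mathbb Z}$, the Jackson integrals $$\mathcal E_q^{[\lambda]}(x)=\frac q{1-p}\int_{\lambda p^{\mathbb Z}}\frac{\psi\left(\frac{\xi}{1-p}\right)}{e_q\left(\frac{q\xi}{(1-p)x}\right)}\,d_p\xi,\qquad E_q^{[\lambda]}(x)=\frac q{1-p}\int_{\lambda p^{\mathbb Z}}\frac{\phi(\xi)}{\theta_p(q\xi/x)}\,d_p\xi$$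 converge absolutely, and $\mathcal E_q^{[\lambda]}(x)=E_q^{[\lambda]}(x)$. -/

import Mathlib

open Real Set Filter Topology MeasureTheory

noncomputable section

/-- The `q`-integer `[n]_q = 1 + q + ⋯ + q^(n-1)`. -/
def qInt (q : ℝ) (n : ℕ) : ℝ := ∑ i ∈ Finset.range n, q ^ i

/-- The `q`-factorial `[n]_q^! = [1]_q [2]_q ⋯ [n]_q`. -/
def qFact (q : ℝ) (n : ℕ) : ℝ := ∏ i ∈ Finset.range n, qInt q (i + 1)

/-- The `q`-exponential `e_q(x) = ∑_{n ≥ 0} x^n / [n]_q^!` (an entire function when `q > 1`). -/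
def qExp (q : ℝ) (x : ℂ) : ℂ := ∑' n : ℕ, x ^ n / (qFact q n : ℂ)

/-- The Theta function `θ_p(x) = ∑_{n ∈ ℤ} p^(n(n-1)/2) x^n` (for `0 < p < 1`, `x ≠ 0`).
The integer `n(n-1)` is always even, so that the integer division is exact. -/
def thetaFn (p : ℝ) (x : ℂ) : ℂ := ∑' n : ℤ, (p : ℂ) ^ (n * (n - 1) / 2) * x ^ n

/-- The formal `q`-Euler series `∑_{n ≥ 0} (-1)^n [n]_q^! x^(n+1)`. -/
def qEulerSeries (q : ℝ) : PowerSeries ℂ :=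
  PowerSeries.X * PowerSeries.mk fun n => (-1) ^ n * (qFact q n : ℂ)

/-- The formal Borel transform `𝓑_q`, sending `∑ a_n x^(n+1)` to `∑ (a_n / [n]_q^!) ξ^n`. -/
def formalBorelFact (q : ℝ) (f : PowerSeries ℂ) : PowerSeries ℂ :=
  PowerSeries.mk fun n => PowerSeries.coeff (n + 1) f / (qFact q n : ℂ)

/-- The formal Borel transform `B_q`, sending `∑ a_n x^(n+1)` to
`∑ (a_n / q^(n(n-1)/2)) ξ^n`. -/
def formalBorelTheta (q : ℝ) (f : PowerSeries ℂ) : PowerSeries ℂ :=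
  PowerSeries.mk fun n => PowerSeries.coeff (n + 1) f / (q : ℂ) ^ (n * (n - 1) / 2)

/-- `g` is an analytic continuation to the open set `U ∋ 0` of the germ at `0` defined by the
power series `S`: the series converges to `g` near `0` and `g` is holomorphic on `U`. -/
def IsContinuationOfSeries (S : PowerSeries ℂ) (U : Set ℂ) (g : ℂ → ℂ) : Prop :=
  (∀ᶠ ξ in 𝓝 (0 : ℂ), HasSum (fun n : ℕ => PowerSeries.coeff n S * ξ ^ n) (g ξ)) ∧
    DifferentiableOn ℂ g U

/-- The integrand of `∫_0^{e^{id}∞} h(ξ) dξ` in the parametrization `ξ = t e^{id}`, `t > 0`. -/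
def rayIntegrand (d : ℝ) (h : ℂ → ℂ) (t : ℝ) : ℂ :=
  h (t * Complex.exp (d * Complex.I)) * Complex.exp (d * Complex.I)

/-- Absolute convergence of `∫_0^{e^{id}∞} h(ξ) dξ`. -/
def RayIntegrable (d : ℝ) (h : ℂ → ℂ) : Prop := IntegrableOn (rayIntegrand d h) (Ioi 0)

/-- The integral `∫_0^{e^{id}∞} h(ξ) dξ`. -/
def rayIntegral (d : ℝ) (h : ℂ → ℂ) : ℂ := ∫ t in Ioi (0 : ℝ), rayIntegrand d h t

/-- (Absolute) convergence of the Jackson integral `∫_{λ p^ℤ} h(ξ) d_p ξ`. -/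
def JacksonSummable (p : ℝ) (l : ℂ) (h : ℂ → ℂ) : Prop :=
  Summable fun n : ℤ => h ((p : ℂ) ^ n * l) * (p : ℂ) ^ n

/-- The Jackson integral `∫_{λ p^ℤ} h(ξ) d_p ξ = (1 - p) λ ∑_{n ∈ ℤ} h(p^n λ) p^n`. -/
def jacksonIntegral (p : ℝ) (l : ℂ) (h : ℂ → ℂ) : ℂ :=
  (1 - p) * l * ∑' n : ℤ, h ((p : ℂ) ^ n * l) * (p : ℂ) ^ n

/-- Integrand `ψ(ξ) / e_q(q ξ / x)` of the continuous Laplace transform with kernel `e_q`. -/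
def expKernel (q : ℝ) (ψ : ℂ → ℂ) (x ξ : ℂ) : ℂ := ψ ξ / qExp q (q * (ξ / x))

/-- Integrand `φ(ξ) / θ_p(q ξ / x)`, `p = 1/q`, of the Laplace transforms with kernel `θ_p`. -/
def thetaKernel (q : ℝ) (φ : ℂ → ℂ) (x ξ : ℂ) : ℂ := φ ξ / thetaFn q⁻¹ (q * (ξ / x))

/-- Integrand `ψ(ξ / (1 - p)) / e_q(q ξ / ((1 - p) x))`, `p = 1/q`, of the discrete Laplace
transform with kernel `e_q`. -/
def expKernelDiscrete (q : ℝ) (ψ : ℂ → ℂ) (x ξ : ℂ) : ℂ :=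
  ψ (ξ / (1 - (q : ℂ)⁻¹)) / qExp q (q * (ξ / ((1 - (q : ℂ)⁻¹) * x)))

/-- `𝓛_q^d ψ (x) = (q - 1) / ln q · ∫_0^{e^{id}∞} ψ(ξ) / e_q(q ξ / x) dξ`. -/
def laplaceExp (q : ℝ) (ψ : ℂ → ℂ) (d : ℝ) (x : ℂ) : ℂ :=
  ((q - 1) / Real.log q : ℝ) * rayIntegral d (expKernel q ψ x)

/-- `L_q^d φ (x) = q / ln q · ∫_0^{e^{id}∞} φ(ξ) / θ_p(q ξ / x) dξ`. -/
def laplaceTheta (q : ℝ) (φ : ℂ → ℂ) (d : ℝ) (x : ℂ) : ℂ :=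
  (q / Real.log q : ℝ) * rayIntegral d (thetaKernel q φ x)

/-- `𝓛_q^[λ] ψ (x) = q / (1 - p) · ∫_{λ p^ℤ} ψ(ξ / (1 - p)) / e_q(q ξ / ((1 - p) x)) d_p ξ`. -/
def laplaceExpDiscrete (q : ℝ) (ψ : ℂ → ℂ) (l x : ℂ) : ℂ :=
  (q / (1 - q⁻¹) : ℝ) * jacksonIntegral q⁻¹ l (expKernelDiscrete q ψ x)

/-- `L_q^[λ] φ (x) = q / (1 - p) · ∫_{λ p^ℤ} φ(ξ) / θ_p(q ξ / x) d_p ξ`. -/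
def laplaceThetaDiscrete (q : ℝ) (φ : ℂ → ℂ) (l x : ℂ) : ℂ :=
  (q / (1 - q⁻¹) : ℝ) * jacksonIntegral q⁻¹ l (thetaKernel q φ x)

/-- The sector `|arg x| < 2π` of the Riemann surface of the logarithm, in the global
coordinate `z = log x`: the point with coordinate `z` lies over `exp z` and has argument
`Im z`. -/
def logSector : Set ℂ := {z | |z.im| < 2 * π}

/-- `F` is holomorphic on the sector `|arg x| < 2π` of the Riemann surface of the logarithm and
continues the function `s`, given on the sector `|arg x - d| < π`. -/
def ContinuesFrom (d : ℝ) (s : ℂ → ℂ) (F : ℂ → ℂ) : Prop :=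
  DifferentiableOn ℂ F logSector ∧ ∀ z : ℂ, |z.im - d| < π → F z = s (Complex.exp z)

end

/-! Put p = 1/q and (u; p)_∞ = ∏ (1 - p^n u). In base p, e_q(x) is (-(1-p)x; p)_∞, and φ(ξ) is the
sum of (p; p)_n u^n with u = -ξ/(1-p). Expanding (p; p)_n = (p; p)_∞ / (p^(n+1); p)_∞ by Euler's
series gives a partial fraction expansion (`hasSum_mittagLeffler`), which is also the continuation
of φ: φ(ξ) = (p; p)_∞ ∑_k p^k / (p; p)_k · ψ(p^k ξ / (1-p)).

The triple product and the quasi-periodicity of θ_p give an expansion of the kernels with matching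
weights (`hasSum_inv_thetaFn`): 1 / (-y; p)_∞ = (p; p)_∞ ∑_k 1 / ((p; p)_k θ_p(y p^(-k))).

Insert the first expansion into the transform with kernel θ_p and, in the k-th term, rescale the ray
by (1-p) p^(-k), or shift the Jackson sum by k steps. Every factor ψ becomes the same, and the
second expansion collects the theta kernels into 1/e_q. This is `integral_tsum_thetaCore` for rays
and `jackson_sums` for spirals.

Convergence and the exchanges of sums and integrals rest on the bounds |(-y; p)_∞|, |θ_p(y)| ≥ m (1
+ |y|²) away from the zeros. For the continuation, the transform is a function of a complex
logarithmic direction w and of z = log x. It is holomorphic in w and invariant under real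
translations of w, hence independent of w; the choice w = z/2 reaches the whole sector |arg x| < 2π.
-/

noncomputable section

/-! ### Euler's two series and the infinite product. -/

/-- The `q`-Pochhammer symbol `(p; p)_n = (1 - p) (1 - p ^ 2) ⋯ (1 - p ^ n)`. -/
def qPoch (p : ℝ) (n : ℕ) : ℝ := ∏ i ∈ Finset.range n, (1 - p ^ (i + 1))

/-- The coefficients `p ^ (n (n - 1) / 2) / (p; p)_n` of Euler's series for `(-z; p)_∞`. -/
def eulerCoeff (p : ℝ) (n : ℕ) : ℂ := (p : ℂ) ^ (n * (n - 1) / 2) / (qPoch p n : ℂ)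

/-- The infinite product `(-z; p)_∞ = ∏_{n ≥ 0} (1 + p ^ n z)`, given by Euler's series. -/
def eulerProd (p : ℝ) (z : ℂ) : ℂ := ∑' n : ℕ, eulerCoeff p n * z ^ n

/-- Euler's series `∑ u ^ k / (p; p)_k`, equal to `1 / (u; p)_∞` for `‖u‖ < 1`. -/
def eulerInv (p : ℝ) (u : ℂ) : ℂ := ∑' k : ℕ, u ^ k / (qPoch p k : ℂ)

lemma qPoch_zero (p : ℝ) : qPoch p 0 = 1 := by simp [qPoch]

lemma qPoch_succ (p : ℝ) (n : ℕ) : qPoch p (n + 1) = qPoch p n * (1 - p ^ (n + 1)) := by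
  simp [qPoch, Finset.prod_range_succ]

lemma qPoch_pos {p : ℝ} (hp0 : 0 < p) (hp1 : p < 1) (n : ℕ) : 0 < qPoch p n :=
  Finset.prod_pos fun i _ => sub_pos.2 (pow_lt_one₀ hp0.le hp1 (by omega))

lemma qPoch_ne_zero {p : ℝ} (hp0 : 0 < p) (hp1 : p < 1) (n : ℕ) : (qPoch p n : ℂ) ≠ 0 :=
  Complex.ofReal_ne_zero.2 (qPoch_pos hp0 hp1 n).ne'

lemma one_sub_pow_pos {p : ℝ} (hp0 : 0 < p) (hp1 : p < 1) (n : ℕ) : 0 < 1 - p ^ (n + 1) :=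
  sub_pos.2 (pow_lt_one₀ hp0.le hp1 (by omega))

lemma one_sub_pow_ne_zero {p : ℝ} (hp0 : 0 < p) (hp1 : p < 1) (n : ℕ) :
    (1 - (p : ℂ) ^ (n + 1)) ≠ 0 := by
  exact_mod_cast (one_sub_pow_pos hp0 hp1 n).ne'

lemma summable_norm_of_norm_succ_eq {f : ℕ → ℂ} {r : ℕ → ℝ} {l : ℝ} (hl : l < 1)
    (hr : Tendsto r atTop (𝓝 l)) (h : ∀ n, ‖f (n + 1)‖ = r n * ‖f n‖) :
    Summable fun n => ‖f n‖ := by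
  obtain ⟨m, hlm, hm⟩ := exists_between hl
  refine summable_of_ratio_norm_eventually_le (r := m) hm ?_
  filter_upwards [hr.eventually (eventually_le_nhds hlm)] with n hn
  rw [norm_norm, norm_norm, h]
  gcongr

lemma tendsto_one_sub_pow {p : ℝ} (hp0 : 0 < p) (hp1 : p < 1) :
    Tendsto (fun n : ℕ => 1 - p ^ (n + 1)) atTop (𝓝 1) := by
  simpa using ((tendsto_pow_atTop_nhds_zero_of_lt_one hp0.le hp1).comp
    (tendsto_add_atTop_nat 1)).const_sub 1

lemma norm_one_sub_pow {p : ℝ} (hp0 : 0 < p) (hp1 : p < 1) (n : ℕ) :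
    ‖1 - (p : ℂ) ^ (n + 1)‖ = 1 - p ^ (n + 1) := by
  have := Complex.norm_of_nonneg (one_sub_pow_pos hp0 hp1 n).le
  simpa using this

lemma eulerCoeff_zero (p : ℝ) : eulerCoeff p 0 = 1 := by simp [eulerCoeff, qPoch_zero]

lemma eulerCoeff_succ (p : ℝ) (n : ℕ) :
    eulerCoeff p (n + 1) = eulerCoeff p n * ((p : ℂ) ^ n / (1 - (p : ℂ) ^ (n + 1))) := by
  rw [eulerCoeff, eulerCoeff, Nat.triangle_succ, qPoch_succ, pow_add]
  push_cast
  rw [mul_div_mul_comm]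

lemma summable_norm_eulerCoeff {p : ℝ} (hp0 : 0 < p) (hp1 : p < 1) (z : ℂ) :
    Summable fun n : ℕ => ‖eulerCoeff p n * z ^ n‖ := by
  refine summable_norm_of_norm_succ_eq (r := fun n => p ^ n / (1 - p ^ (n + 1)) * ‖z‖)
    (l := 0 / 1 * ‖z‖) (by simp) ?_ fun n => ?_
  · exact ((tendsto_pow_atTop_nhds_zero_of_lt_one hp0.le hp1).div
      (tendsto_one_sub_pow hp0 hp1) one_ne_zero).mul_const _
  · rw [eulerCoeff_succ, pow_succ z]
    simp only [norm_mul, norm_div, norm_pow, norm_one_sub_pow hp0 hp1, Complex.norm_real,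
      Real.norm_of_nonneg hp0.le]
    ring

lemma summable_eulerCoeff {p : ℝ} (hp0 : 0 < p) (hp1 : p < 1) (z : ℂ) :
    Summable fun n : ℕ => eulerCoeff p n * z ^ n := (summable_norm_eulerCoeff hp0 hp1 z).of_norm

lemma eulerProd_zero (p : ℝ) : eulerProd p 0 = 1 := by
  rw [eulerProd, tsum_eq_single 0 (fun n hn => by simp [hn])]
  simp [eulerCoeff_zero]

/-- A power series without constant term and with `a (n + 1) = b n` is `z` times the series of
the `b n`. -/
lemma tsum_eq_mul_tsum_of_succ {a b : ℕ → ℂ} {z : ℂ} (ha : Summable a) (h0 : a 0 = 0)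
    (h : ∀ n, a (n + 1) = z * b n) : ∑' n, a n = z * ∑' n, b n := by
  rw [ha.tsum_eq_zero_add, h0, zero_add, ← tsum_mul_left]
  exact tsum_congr h

lemma eulerProd_eq_mul {p : ℝ} (hp0 : 0 < p) (hp1 : p < 1) (z : ℂ) :
    eulerProd p z = (1 + z) * eulerProd p (p * z) := by
  have h1 := summable_eulerCoeff hp0 hp1 z
  have h2 := summable_eulerCoeff hp0 hp1 (p * z)
  have key := tsum_eq_mul_tsum_of_succ (b := fun n => eulerCoeff p n * (p * z) ^ n) (z := z)
    (h1.sub h2) (by simp) fun n => by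
      rw [eulerCoeff_succ]
      have := one_sub_pow_ne_zero hp0 hp1 n
      field_simp
      ring
  rw [h1.tsum_sub h2] at key
  simp only [eulerProd]
  linear_combination key

lemma eulerProd_eq_prod_mul {p : ℝ} (hp0 : 0 < p) (hp1 : p < 1) (z : ℂ) (N : ℕ) :
    eulerProd p z = (∏ j ∈ Finset.range N, (1 + (p : ℂ) ^ j * z)) * eulerProd p (p ^ N * z) := by
  induction N with
  | zero => simp
  | succ N ih =>
    rw [ih, Finset.prod_range_succ, eulerProd_eq_mul hp0 hp1 (p ^ N * z)]
    ring_nf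

lemma differentiable_eulerProd {p : ℝ} (hp0 : 0 < p) (hp1 : p < 1) :
    Differentiable ℂ (eulerProd p) := by
  intro z
  have hu := summable_norm_eulerCoeff hp0 hp1 ((‖z‖ + 1 : ℝ) : ℂ)
  refine (Complex.differentiableOn_tsum_of_summable_norm (U := Metric.ball 0 (‖z‖ + 1)) hu
    (fun n => by fun_prop) Metric.isOpen_ball fun n w hw => ?_).differentiableAt
    (Metric.isOpen_ball.mem_nhds (by simp))
  rw [mem_ball_zero_iff] at hw
  rw [norm_mul, norm_mul, norm_pow, norm_pow, Complex.norm_of_nonneg (by positivity)]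
  gcongr

lemma tendsto_pow_mul_zero {p : ℝ} (hp0 : 0 < p) (hp1 : p < 1) (z : ℂ) :
    Tendsto (fun N : ℕ => (p : ℂ) ^ N * z) atTop (𝓝 0) := by
  have : Tendsto (fun N : ℕ => (p : ℂ) ^ N) atTop (𝓝 0) :=
    tendsto_pow_atTop_nhds_zero_of_norm_lt_one (by simpa [abs_of_pos hp0] using hp1)
  simpa using this.mul_const z

lemma tendsto_eulerProd_one {p : ℝ} (hp0 : 0 < p) (hp1 : p < 1) :
    Tendsto (eulerProd p) (𝓝 0) (𝓝 1) := by
  simpa [eulerProd_zero] using (differentiable_eulerProd hp0 hp1).continuous.tendsto 0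

/-- Far out, the tail of the product is close to 1, so only finitely many factors could vanish. -/
lemma eulerProd_ne_zero {p : ℝ} (hp0 : 0 < p) (hp1 : p < 1) {z : ℂ}
    (hz : ∀ n : ℕ, 1 + (p : ℂ) ^ n * z ≠ 0) : eulerProd p z ≠ 0 := by
  have h := ((tendsto_eulerProd_one hp0 hp1).comp (tendsto_pow_mul_zero hp0 hp1 z)).eventually_ne
    one_ne_zero
  obtain ⟨N, hN⟩ := h.exists
  rw [eulerProd_eq_prod_mul hp0 hp1 z N]
  exact mul_ne_zero (Finset.prod_ne_zero_iff.2 fun j _ => hz j) hN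

lemma eulerProd_neg_ne_zero {p : ℝ} (hp0 : 0 < p) (hp1 : p < 1) {z : ℂ} (hz : ‖z‖ < 1) :
    eulerProd p z ≠ 0 := by
  refine eulerProd_ne_zero hp0 hp1 fun n h => ?_
  have h1 : ‖(p : ℂ) ^ n * z‖ = 1 := by
    rw [eq_neg_of_add_eq_zero_right h, norm_neg, norm_one]
  rw [norm_mul, norm_pow, Complex.norm_of_nonneg hp0.le] at h1
  nlinarith [pow_le_one₀ (n := n) hp0.le hp1.le, norm_nonneg z]

lemma qPoch_mul_eulerProd {p : ℝ} (hp0 : 0 < p) (hp1 : p < 1) (n : ℕ) :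
    (qPoch p n : ℂ) * eulerProd p (-(p : ℂ) ^ (n + 1)) = eulerProd p (-p) := by
  rw [eulerProd_eq_prod_mul hp0 hp1 (-p) n, qPoch]
  push_cast
  congr 1
  · exact Finset.prod_congr rfl fun i _ => by ring
  · congr 1; ring

/-- The factor of index j is zero. This lets a sum over ℕ be extended to ℤ in the triple product. -/
lemma eulerProd_neg_zpow_eq_zero {p : ℝ} (hp0 : 0 < p) (hp1 : p < 1) (j : ℕ) :
    eulerProd p (-(p : ℂ) ^ (-(j : ℤ))) = 0 := by
  have hp : (p : ℂ) ≠ 0 := Complex.ofReal_ne_zero.2 hp0.ne'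
  rw [eulerProd_eq_prod_mul hp0 hp1 _ (j + 1), Finset.prod_range_succ, zpow_neg, zpow_natCast]
  field_simp
  simp

lemma summable_norm_eulerInv {p : ℝ} (hp0 : 0 < p) (hp1 : p < 1) {u : ℂ} (hu : ‖u‖ < 1) :
    Summable fun k : ℕ => ‖u ^ k / (qPoch p k : ℂ)‖ := by
  refine summable_norm_of_norm_succ_eq (r := fun n => ‖u‖ / (1 - p ^ (n + 1)))
    (l := ‖u‖ / 1) (by simpa) ?_ fun n => ?_
  · exact tendsto_const_nhds.div (tendsto_one_sub_pow hp0 hp1) one_ne_zero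
  · rw [qPoch_succ, pow_succ u]
    push_cast
    simp only [norm_mul, norm_div, norm_pow, norm_one_sub_pow hp0 hp1]
    rw [mul_comm (‖u‖ ^ n), mul_comm ‖(qPoch p n : ℂ)‖, mul_div_mul_comm]

lemma eulerInv_mul {p : ℝ} (hp0 : 0 < p) (hp1 : p < 1) {u : ℂ} (hu : ‖u‖ < 1) :
    (1 - u) * eulerInv p u = eulerInv p (p * u) := by
  have hu' : ‖(p : ℂ) * u‖ < 1 := by
    rw [norm_mul, Complex.norm_of_nonneg hp0.le]
    nlinarith [norm_nonneg u]
  have h1 := (summable_norm_eulerInv hp0 hp1 hu).of_norm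
  have h2 := (summable_norm_eulerInv hp0 hp1 hu').of_norm
  have key := tsum_eq_mul_tsum_of_succ (b := fun k => u ^ k / (qPoch p k : ℂ)) (z := u)
    (h1.sub h2) (by simp) fun n => by
      rw [qPoch_succ]
      push_cast
      have := one_sub_pow_ne_zero hp0 hp1 n
      have := qPoch_ne_zero hp0 hp1 n
      field_simp
      ring
  rw [h1.tsum_sub h2] at key
  simp only [eulerInv]
  linear_combination key

lemma tendsto_eulerInv_one {p : ℝ} (hp0 : 0 < p) (hp1 : p < 1) :
    Tendsto (eulerInv p) (𝓝 0) (𝓝 1) := by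
  have h0 : eulerInv p 0 = 1 := by
    rw [eulerInv, tsum_eq_single 0 (fun n hn => by simp [hn])]
    simp [qPoch_zero]
  rw [← h0]
  have hu := summable_norm_eulerInv hp0 hp1 (u := (1 / 2 : ℝ))
    (by rw [Complex.norm_of_nonneg (by norm_num)]; norm_num)
  refine ((Complex.differentiableOn_tsum_of_summable_norm (U := Metric.ball 0 (1 / 2)) hu
    (fun n => by fun_prop) Metric.isOpen_ball fun n w hw => ?_).differentiableAt
    (Metric.isOpen_ball.mem_nhds (by simp))).continuousAt
  rw [mem_ball_zero_iff] at hw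
  rw [norm_div, norm_div, norm_pow, norm_pow,
    Complex.norm_of_nonneg (by norm_num : (0 : ℝ) ≤ 1 / 2)]
  gcongr

/-- Euler's identity `(u; p)_∞⁻¹ = ∑ u ^ k / (p; p)_k`. -/
lemma eulerInv_mul_eulerProd {p : ℝ} (hp0 : 0 < p) (hp1 : p < 1) {u : ℂ} (hu : ‖u‖ < 1) :
    eulerInv p u * eulerProd p (-u) = 1 := by
  -- The product of the two series is invariant under u ↦ p u, because both functional equations
  -- involve the same factor 1 - u. Its value is therefore the limit 1 at 0.
  have step : ∀ N : ℕ, ‖(p : ℂ) ^ N * u‖ < 1 ∧ eulerInv p (p ^ N * u) * eulerProd p (-(p ^ N * u)) =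
      eulerInv p u * eulerProd p (-u) := by
    intro N
    induction N with
    | zero => simpa using hu
    | succ N ih =>
      have e : (p : ℂ) ^ (N + 1) * u = p * (p ^ N * u) := by ring
      refine ⟨?_, ?_⟩
      · rw [e, norm_mul, Complex.norm_of_nonneg hp0.le]
        nlinarith [norm_nonneg ((p : ℂ) ^ N * u), ih.1]
      · rw [← ih.2, e, ← eulerInv_mul hp0 hp1 ih.1, eulerProd_eq_mul hp0 hp1 (-(p ^ N * u))]
        ring_nf
  have h1 := tendsto_pow_mul_zero hp0 hp1 u
  have h2 : Tendsto (fun N : ℕ => -((p : ℂ) ^ N * u)) atTop (𝓝 0) := by simpa using h1.neg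
  have h := ((tendsto_eulerInv_one hp0 hp1).comp h1).mul ((tendsto_eulerProd_one hp0 hp1).comp h2)
  simp only [Function.comp_def, (step _).2, mul_one] at h
  exact tendsto_nhds_unique tendsto_const_nhds h

/-! ### The Theta function and Jacobi's triple product. -/

lemma triangle_add_one (n : ℤ) : (n + 1) * (n + 1 - 1) / 2 = n * (n - 1) / 2 + n := by
  have : (n + 1) * (n + 1 - 1) = n * (n - 1) + n * 2 := by ring
  rw [this, Int.add_mul_ediv_right _ _ two_ne_zero]

lemma triangle_add_nat (n : ℤ) (k : ℕ) :
    (n + k) * (n + k - 1) / 2 = n * (n - 1) / 2 + ((k * (k - 1) / 2 : ℕ) : ℤ) + n * k := by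
  induction k with
  | zero => simp
  | succ k ih =>
    rw [Nat.triangle_succ]
    push_cast at ih ⊢
    rw [← add_assoc, triangle_add_one, ih]
    ring

/-- The terms of the series defining the Theta function. -/
def thetaTerm (p : ℝ) (x : ℂ) (n : ℤ) : ℂ := (p : ℂ) ^ (n * (n - 1) / 2) * x ^ n

lemma thetaTerm_add_one {p : ℝ} (hp0 : 0 < p) {x : ℂ} (hx : x ≠ 0) (n : ℤ) :
    thetaTerm p x (n + 1) = (p : ℂ) ^ n * x * thetaTerm p x n := by
  have hp : (p : ℂ) ≠ 0 := Complex.ofReal_ne_zero.2 hp0.ne'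
  rw [thetaTerm, thetaTerm, triangle_add_one, zpow_add₀ hp, zpow_add_one₀ hx]
  ring

lemma thetaTerm_natCast (p : ℝ) (x : ℂ) (n : ℕ) :
    thetaTerm p x n = (p : ℂ) ^ (n * (n - 1) / 2) * x ^ n := by
  have := triangle_add_nat 0 n
  simp only [zero_add, zero_mul, Int.zero_ediv, add_zero] at this
  rw [thetaTerm, this, zpow_natCast, zpow_natCast]

lemma summable_norm_thetaTerm {p : ℝ} (hp0 : 0 < p) (hp1 : p < 1) {x : ℂ} (hx : x ≠ 0) :
    Summable fun n : ℤ => ‖thetaTerm p x n‖ := by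
  have hp : (p : ℂ) ≠ 0 := Complex.ofReal_ne_zero.2 hp0.ne'
  have ht := tendsto_pow_atTop_nhds_zero_of_lt_one hp0.le hp1
  refine Summable.of_nat_of_neg ?_ ?_
  · refine summable_norm_of_norm_succ_eq (f := fun n : ℕ => thetaTerm p x n)
      (r := fun n => p ^ n * ‖x‖) (l := 0 * ‖x‖) (by simp) (ht.mul_const _) fun n => ?_
    push_cast
    rw [thetaTerm_add_one hp0 hx]
    simp [abs_of_pos hp0]
  · refine summable_norm_of_norm_succ_eq (f := fun n : ℕ => thetaTerm p x (-n))
      (r := fun n => p ^ (n + 1) * ‖x‖⁻¹) (l := 0 * ‖x‖⁻¹) (by simp)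
      ((ht.comp (tendsto_add_atTop_nat 1)).mul_const _) fun n => ?_
    have h := thetaTerm_add_one hp0 hx (-((n + 1 : ℕ) : ℤ))
    have e : -((n + 1 : ℕ) : ℤ) + 1 = -(n : ℤ) := by push_cast; ring
    rw [e] at h
    rw [h, norm_mul, norm_mul, zpow_neg, zpow_natCast, norm_inv, norm_pow,
      Complex.norm_of_nonneg hp0.le]
    have := norm_ne_zero_iff.2 hx
    field_simp

lemma thetaFn_p_mul {p : ℝ} (hp0 : 0 < p) {x : ℂ} (hx : x ≠ 0) :
    thetaFn p (p * x) = x⁻¹ * thetaFn p x := by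
  have hp : (p : ℂ) ≠ 0 := Complex.ofReal_ne_zero.2 hp0.ne'
  change ∑' n, thetaTerm p (p * x) n = x⁻¹ * ∑' n, thetaTerm p x n
  rw [← (Equiv.addRight (1 : ℤ)).tsum_eq (thetaTerm p x), ← tsum_mul_left]
  refine tsum_congr fun n => ?_
  rw [Equiv.coe_addRight, thetaTerm_add_one hp0 hx, thetaTerm, thetaTerm, mul_zpow]
  field_simp

/-- The shear `(m, k) ↦ (m - k, k)` of `ℤ × ℕ`. -/
def shearEquiv : ℤ × ℕ ≃ ℤ × ℕ where
  toFun a := (a.1 - a.2, a.2)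
  invFun a := (a.1 + a.2, a.2)
  left_inv a := by simp
  right_inv a := by simp

/-- Multiplying Euler's series for (-y; p)_∞ by (p; p)_∞ replaces 1/(p; p)_n by (p^(n+1); p)_∞.
Expanding this factor again gives a double series over ℤ × ℕ, and the shear n = m - k completes the
triangular exponents, so that it factors. The condition p < ‖y‖ is what makes the series in p/y
converge. -/
lemma eulerProd_mul_eulerProd_neg {p : ℝ} (hp0 : 0 < p) (hp1 : p < 1) {y : ℂ} (hy : p < ‖y‖) :
    eulerProd p (-p) * eulerProd p y = thetaFn p y * eulerInv p (-(p / y)) := by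
  have hp : (p : ℂ) ≠ 0 := Complex.ofReal_ne_zero.2 hp0.ne'
  have hy0 : y ≠ 0 := norm_pos_iff.1 (hp0.trans hy)
  have hu : ‖-((p : ℂ) / y)‖ < 1 := by
    rw [norm_neg, norm_div, Complex.norm_of_nonneg hp0.le]
    exact (div_lt_one (hp0.trans hy)).2 hy
  obtain ⟨A, hA⟩ : ∃ A : ℤ × ℕ → ℂ, ∀ a, A a =
      thetaTerm p y a.1 * (eulerCoeff p a.2 * (-(p : ℂ) ^ (a.1 + 1)) ^ a.2) := ⟨_, fun _ => rfl⟩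
  have hs : A ∘ shearEquiv = fun a =>
      thetaTerm p y a.1 * ((-(p / y)) ^ a.2 / (qPoch p a.2 : ℂ)) := by
    ext ⟨m, k⟩
    obtain ⟨n, rfl⟩ : ∃ n : ℤ, m = n + k := ⟨m - k, by ring⟩
    simp only [Function.comp_apply, hA, shearEquiv, Equiv.coe_fn_mk, add_sub_cancel_right,
      thetaTerm, eulerCoeff]
    rw [triangle_add_nat, neg_pow, neg_pow (p / y : ℂ)]
    simp only [zpow_add₀ hp, zpow_add₀ hy0, zpow_mul, zpow_natCast, zpow_one, mul_pow, div_pow]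
    field_simp
  have hT := summable_norm_thetaTerm hp0 hp1 hy0
  have hQ := summable_norm_eulerInv hp0 hp1 hu
  have hsum : Summable A := by
    rw [← shearEquiv.summable_iff, hs]
    exact summable_mul_of_summable_norm (f := thetaTerm p y)
      (g := fun k : ℕ => (-((p : ℂ) / y)) ^ k / (qPoch p k : ℂ)) hT hQ
  have h2 : ∑' a, A a = thetaFn p y * eulerInv p (-(p / y)) := by
    rw [← shearEquiv.tsum_eq]
    change ∑' a, (A ∘ shearEquiv) a = _
    rw [hs]
    exact (tsum_mul_tsum_of_summable_norm (f := thetaTerm p y)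
      (g := fun k : ℕ => (-((p : ℂ) / y)) ^ k / (qPoch p k : ℂ)) hT hQ).symm
  rw [← h2, hsum.tsum_prod]
  simp only [hA, tsum_mul_left]
  change _ = ∑' n : ℤ, thetaTerm p y n * eulerProd p (-(p : ℂ) ^ (n + 1))
  -- The terms with n < 0 vanish, since then (p^(n+1); p)_∞ contains a zero factor.
  rw [← (Nat.cast_injective (R := ℤ)).tsum_eq, eulerProd.eq_def p y, ← tsum_mul_left]
  · refine tsum_congr fun n => ?_
    have := qPoch_mul_eulerProd hp0 hp1 n
    have h0 := qPoch_ne_zero hp0 hp1 n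
    have e : ((n : ℤ) + 1) = ((n + 1 : ℕ) : ℤ) := by push_cast; ring
    rw [e, zpow_natCast, ← this, eulerCoeff, thetaTerm_natCast]
    field_simp
  · intro n hn
    by_contra h
    apply hn
    have hneg : n < 0 := by
      by_contra h'
      exact h ⟨n.toNat, by omega⟩
    have e : n + 1 = -(((-(n + 1)).toNat : ℕ) : ℤ) := by omega
    simp only
    rw [e, eulerProd_neg_zpow_eq_zero hp0 hp1, mul_zero]

/-- Jacobi's triple product identity `θ_p(y) = (p; p)_∞ (-y; p)_∞ (-p / y; p)_∞`. -/
lemma thetaFn_eq_eulerProd {p : ℝ} (hp0 : 0 < p) (hp1 : p < 1) {y : ℂ} (hy : y ≠ 0) :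
    thetaFn p y = eulerProd p (-p) * eulerProd p y * eulerProd p (p / y) := by
  have hp : (p : ℂ) ≠ 0 := Complex.ofReal_ne_zero.2 hp0.ne'
  have big : ∀ y : ℂ, p < ‖y‖ →
      thetaFn p y = eulerProd p (-p) * eulerProd p y * eulerProd p (p / y) := by
    intro y hy
    have hu : ‖-((p : ℂ) / y)‖ < 1 := by
      rw [norm_neg, norm_div, Complex.norm_of_nonneg hp0.le]
      exact (div_lt_one (hp0.trans hy)).2 hy
    have h := eulerInv_mul_eulerProd hp0 hp1 hu
    rw [neg_neg] at h
    rw [eulerProd_mul_eulerProd_neg hp0 hp1 hy, mul_assoc, h, mul_one]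
  have step : ∀ y : ℂ, y ≠ 0 →
      thetaFn p y = eulerProd p (-p) * eulerProd p y * eulerProd p (p / y) →
      thetaFn p (p * y) =
        eulerProd p (-p) * eulerProd p (p * y) * eulerProd p (p / (p * y)) := by
    intro y hy h
    have e1 : (p : ℂ) / (p * y) = y⁻¹ := by field_simp
    rw [thetaFn_p_mul hp0 hy, h, eulerProd_eq_mul hp0 hp1 y, e1, eulerProd_eq_mul hp0 hp1 y⁻¹,
      ← div_eq_mul_inv]
    field_simp
    ring
  -- The point y / p^N has norm above 1, hence above p, where the identity is known; N applications
  -- of `step` bring it back to y.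
  obtain ⟨N, hN⟩ := exists_pow_lt_of_lt_one (norm_pos_iff.2 hy) hp1
  have hN' : p ^ N * p < ‖y‖ := by nlinarith [pow_pos hp0 N]
  have key : ∀ k : ℕ, thetaFn p (p ^ k * (y / p ^ N)) = eulerProd p (-p) *
      eulerProd p (p ^ k * (y / p ^ N)) * eulerProd p (p / (p ^ k * (y / p ^ N))) := by
    intro k
    induction k with
    | zero =>
      rw [pow_zero, one_mul]
      apply big
      rw [norm_div, norm_pow, Complex.norm_of_nonneg hp0.le, lt_div_iff₀ (by positivity)]
      linarith
    | succ k ih =>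
      have := step (p ^ k * (y / p ^ N)) (by positivity) ih
      rwa [← mul_assoc, ← pow_succ'] at this
  have := key N
  rwa [mul_div_cancel₀ y (pow_ne_zero N hp)] at this

/-! ### Expansion of the kernel 1/e_q in theta kernels. -/

lemma thetaFn_div_pow {p : ℝ} (hp0 : 0 < p) {y : ℂ} (hy : y ≠ 0) (k : ℕ) :
    thetaFn p (y / p ^ k) * ((p : ℂ) ^ (k * (k - 1) / 2) * (p / y) ^ k) = thetaFn p y := by
  have hp : (p : ℂ) ≠ 0 := Complex.ofReal_ne_zero.2 hp0.ne'
  induction k with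
  | zero => simp
  | succ k ih =>
    have hne : y / p ^ (k + 1) ≠ 0 := div_ne_zero hy (pow_ne_zero _ hp)
    have h := thetaFn_p_mul hp0 hne
    have e : (p : ℂ) * (y / p ^ (k + 1)) = y / p ^ k := by rw [pow_succ]; field_simp
    rw [e] at h
    rw [← ih, h, Nat.triangle_succ]
    obtain ⟨t, ht⟩ : ∃ t : ℂ, thetaFn p (y / p ^ (k + 1)) = t := ⟨_, rfl⟩
    rw [ht, div_pow, div_pow, pow_add]
    field_simp
    ring

/-- Summation of the reciprocals of the Theta function along a half spiral. -/
lemma hasSum_inv_thetaFn {p : ℝ} (hp0 : 0 < p) (hp1 : p < 1) {y : ℂ} (hy : y ≠ 0)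
    (h1 : eulerProd p (p / y) ≠ 0) :
    HasSum (fun k : ℕ => eulerProd p (-p) / (qPoch p k : ℂ) / thetaFn p (y / p ^ k))
      (1 / eulerProd p y) := by
  have hp : (p : ℂ) ≠ 0 := Complex.ofReal_ne_zero.2 hp0.ne'
  have h0 : eulerProd p (-p) ≠ 0 := eulerProd_neg_ne_zero hp0 hp1
    (by rw [norm_neg, Complex.norm_of_nonneg hp0.le]; exact hp1)
  have h := ((summable_eulerCoeff hp0 hp1 (p / y)).hasSum).mul_left
    (eulerProd p (-p) / thetaFn p y)
  -- By quasi-periodicity the sum is a multiple of Euler's series at p/y, which cancels one factor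
  -- of the triple product. If `eulerProd p y` is zero, both sides are 0 by the convention on
  -- division.
  have e : eulerProd p (-p) / thetaFn p y * ∑' k : ℕ, eulerCoeff p k * (p / y) ^ k =
      1 / eulerProd p y := by
    rw [← eulerProd, thetaFn_eq_eulerProd hp0 hp1 hy]
    rw [← div_div, div_mul_cancel₀ _ h1, div_mul_eq_div_div, div_self h0]
  rw [e] at h
  refine h.congr_fun fun k => ?_
  have hc : (p : ℂ) ^ (k * (k - 1) / 2) * (p / y) ^ k ≠ 0 := by positivity
  rw [← thetaFn_div_pow hp0 hy k, eulerCoeff, ← div_div]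
  field_simp

/-! ### Partial fractions for the Borel transform. -/

/-- The partial fraction expansion of `∑ (p; p)_n u ^ n`. -/
def mittagLeffler (p : ℝ) (u : ℂ) : ℂ :=
  ∑' k : ℕ, eulerProd p (-p) * ((p : ℂ) ^ k / (qPoch p k : ℂ)) / (1 - u * p ^ k)

lemma norm_p_lt_one {p : ℝ} (hp0 : 0 < p) (hp1 : p < 1) : ‖(p : ℂ)‖ < 1 := by
  rwa [Complex.norm_of_nonneg hp0.le]

lemma summable_weight {p : ℝ} (hp0 : 0 < p) (hp1 : p < 1) :
    Summable fun k : ℕ => ‖eulerProd p (-p) * ((p : ℂ) ^ k / (qPoch p k : ℂ))‖ := by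
  simp only [norm_mul (eulerProd p (-p))]
  exact (summable_norm_eulerInv hp0 hp1 (norm_p_lt_one hp0 hp1)).mul_left _

/-- Both sides are iterated sums of one absolutely convergent double series: summing over k first
uses Euler's series for 1/(p^(n+1); p)_∞, and summing over n first gives geometric series. -/
lemma hasSum_mittagLeffler {p : ℝ} (hp0 : 0 < p) (hp1 : p < 1) {u : ℂ} (hu : ‖u‖ < 1) :
    HasSum (fun n : ℕ => (qPoch p n : ℂ) * u ^ n) (mittagLeffler p u) := by
  have hpn := Complex.norm_of_nonneg hp0.le
  have hup : ∀ k : ℕ, ‖u * p ^ k‖ ≤ ‖u‖ := fun k => by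
    rw [norm_mul, norm_pow, hpn]
    exact mul_le_of_le_one_right (norm_nonneg _) (pow_le_one₀ hp0.le hp1.le)
  obtain ⟨B, hB⟩ : ∃ B : ℕ × ℕ → ℂ, ∀ a, B a =
      eulerProd p (-p) * ((p : ℂ) ^ a.2 / (qPoch p a.2 : ℂ)) * (u * p ^ a.2) ^ a.1 :=
    ⟨_, fun _ => rfl⟩
  have hsum : Summable B := by
    have hg : Summable fun a : ℕ × ℕ =>
        ‖u‖ ^ a.1 * ‖eulerProd p (-p) * ((p : ℂ) ^ a.2 / (qPoch p a.2 : ℂ))‖ :=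
      (summable_geometric_of_lt_one (norm_nonneg u) hu).mul_of_nonneg
        (summable_weight hp0 hp1) (fun n => by positivity) fun k => norm_nonneg _
    refine Summable.of_norm_bounded hg fun a => ?_
    rw [hB, norm_mul, norm_pow, mul_comm]
    gcongr
    exact hup _
  have h1 : HasSum (fun n : ℕ => (qPoch p n : ℂ) * u ^ n) (∑' a, B a) := by
    refine hsum.hasSum.prod_fiberwise fun n => ?_
    have hpn1 : ‖(p : ℂ) ^ (n + 1)‖ < 1 := by
      rw [norm_pow, hpn]
      exact pow_lt_one₀ hp0.le hp1 (by omega)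
    have hq := ((summable_norm_eulerInv hp0 hp1 hpn1).of_norm.hasSum).mul_left
      (eulerProd p (-p) * u ^ n)
    have e : eulerProd p (-p) * u ^ n * ∑' k : ℕ, ((p : ℂ) ^ (n + 1)) ^ k / (qPoch p k : ℂ) =
        (qPoch p n : ℂ) * u ^ n := by
      have := eulerInv_mul_eulerProd hp0 hp1 hpn1
      rw [← eulerInv, ← qPoch_mul_eulerProd hp0 hp1 n]
      linear_combination (qPoch p n : ℂ) * u ^ n * this
    rw [e] at hq
    refine hq.congr_fun fun k => ?_
    rw [hB]
    simp only
    ring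
  have h2 : ∑' a, B a = mittagLeffler p u := by
    have hsw : Summable fun a => B (Equiv.prodComm ℕ ℕ a) :=
      (Equiv.prodComm ℕ ℕ).summable_iff.2 hsum
    rw [← (Equiv.prodComm ℕ ℕ).tsum_eq, hsw.tsum_prod]
    refine tsum_congr fun k => ?_
    simp only [Equiv.prodComm_apply, Prod.swap_prod_mk, hB]
    rw [tsum_mul_left, tsum_geometric_of_norm_lt_one ((hup k).trans_lt hu), ← div_eq_mul_inv]
  rwa [h2] at h1

lemma exists_pos_le_of_tendsto {f : ℕ → ℝ} {l : ℝ} (hl : 0 < l) (hf : Tendsto f atTop (𝓝 l))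
    (hpos : ∀ n, 0 < f n) : ∃ δ > 0, ∀ n, δ ≤ f n := by
  obtain ⟨M, hM⟩ := (hf.inv₀ hl.ne').bddAbove_range
  have hM' : ∀ n, (f n)⁻¹ ≤ M := fun n => hM ⟨n, rfl⟩
  have hM0 : 0 < M := (inv_pos.2 (hpos 0)).trans_le (hM' 0)
  exact ⟨M⁻¹, inv_pos.2 hM0, fun n => (inv_le_comm₀ (hpos n) hM0).1 (hM' n)⟩

lemma exists_le_norm_one_sub {p : ℝ} (hp0 : 0 < p) (hp1 : p < 1) {u : ℂ}
    (hu : ∀ k : ℕ, 1 - u * (p : ℂ) ^ k ≠ 0) : ∃ δ > 0, ∀ k : ℕ, δ ≤ ‖1 - u * (p : ℂ) ^ k‖ := by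
  refine exists_pos_le_of_tendsto one_pos ?_ fun k => norm_pos_iff.2 (hu k)
  have := ((tendsto_pow_mul_zero hp0 hp1 u).const_sub 1).norm
  simpa [mul_comm u] using this

/-- On a ball of radius δ/2 all denominators stay above δ/2 at once, since |p^k| ≤ 1; the weights
then give uniform convergence. -/
lemma differentiableAt_mittagLeffler {p : ℝ} (hp0 : 0 < p) (hp1 : p < 1) {u : ℂ}
    (hu : ∀ k : ℕ, 1 - u * (p : ℂ) ^ k ≠ 0) : DifferentiableAt ℂ (mittagLeffler p) u := by
  obtain ⟨δ, hδ, h⟩ := exists_le_norm_one_sub hp0 hp1 hu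
  have hb : ∀ w ∈ Metric.ball u (δ / 2), ∀ k : ℕ, δ / 2 ≤ ‖1 - w * (p : ℂ) ^ k‖ := by
    intro w hw k
    have h1 : ‖(w - u) * (p : ℂ) ^ k‖ ≤ δ / 2 := by
      rw [norm_mul, norm_pow, Complex.norm_of_nonneg hp0.le]
      rw [mem_ball_iff_norm] at hw
      exact (mul_le_of_le_one_right (norm_nonneg _) (pow_le_one₀ hp0.le hp1.le)).trans hw.le
    have h2 : 1 - u * (p : ℂ) ^ k = (1 - w * (p : ℂ) ^ k) + (w - u) * (p : ℂ) ^ k := by ring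
    have h3 := h k
    rw [h2] at h3
    linarith [norm_add_le (1 - w * (p : ℂ) ^ k) ((w - u) * (p : ℂ) ^ k)]
  refine (Complex.differentiableOn_tsum_of_summable_norm (U := Metric.ball u (δ / 2))
    ((summable_weight hp0 hp1).div_const (δ / 2)) (fun k => ?_) Metric.isOpen_ball
    fun k w hw => ?_).differentiableAt (Metric.isOpen_ball.mem_nhds (by simpa))
  · refine DifferentiableOn.div (by fun_prop) (by fun_prop) fun w hw => ?_
    exact norm_pos_iff.1 ((half_pos hδ).trans_le (hb w hw k))
  · rw [norm_div]
    gcongr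
    exact hb w hw k

/-! ### Quadratic lower bounds for the kernels. -/

/-- For ‖y‖ ≤ 2, finitely many factors of size at least c separate y from a neighbourhood of 0 where
the product exceeds 1/2. Larger y reduce to this case by y ↦ p y, and two factors split off at the
end supply the quadratic growth. -/
lemma exists_eulerProd_lower_bound {p : ℝ} (hp0 : 0 < p) (hp1 : p < 1) {S : Set ℂ}
    (hS : ∀ y ∈ S, (p : ℂ) * y ∈ S) {c : ℝ} (hc : 0 < c) (hSc : ∀ y ∈ S, c ≤ ‖1 + y‖) :
    ∃ m > 0, ∀ y ∈ S, m * (1 + ‖y‖ ^ 2) ≤ ‖eulerProd p y‖ := by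
  have hpn := Complex.norm_of_nonneg hp0.le
  have hSn : ∀ n : ℕ, ∀ y ∈ S, (p : ℂ) ^ n * y ∈ S := by
    intro n y hy
    induction n with
    | zero => simpa
    | succ n ih => simpa only [pow_succ', mul_assoc] using hS _ ih
  have hbig : ∀ y : ℂ, 2 < ‖y‖ → ‖y‖ - 1 ≤ ‖1 + y‖ := fun y _ => by
    have := norm_sub_norm_le y (-1)
    rwa [norm_neg, norm_one, sub_neg_eq_add, add_comm y] at this
  obtain ⟨ε, hε, hε'⟩ := Metric.eventually_nhds_iff.1 ((tendsto_eulerProd_one hp0 hp1).norm.eventually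
    (le_mem_nhds (a := (1 / 2 : ℝ)) (by rw [norm_one]; norm_num)))
  obtain ⟨N, hN⟩ := exists_pow_lt_of_lt_one (half_pos hε) hp1
  have hA : ∀ y ∈ S, ‖y‖ ≤ 2 → c ^ N / 2 ≤ ‖eulerProd p y‖ := by
    intro y hy hy2
    rw [eulerProd_eq_prod_mul hp0 hp1 y N, norm_mul, norm_prod, div_eq_mul_one_div]
    gcongr
    · calc c ^ N = ∏ j ∈ Finset.range N, c := by simp
        _ ≤ _ := Finset.prod_le_prod (fun _ _ => hc.le) fun j _ => hSc _ (hSn j y hy)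
    · apply hε'
      rw [dist_zero_right, norm_mul, norm_pow, hpn]
      nlinarith [norm_nonneg y, pow_pos hp0 N]
  -- For ‖y‖ > 2 the factor 1 + y has norm at least 1, so the bound passes from p y to y.
  have hB : ∀ n : ℕ, ∀ y ∈ S, p ^ n * ‖y‖ ≤ 2 → c ^ N / 2 ≤ ‖eulerProd p y‖ := by
    intro n
    induction n with
    | zero => simpa using hA
    | succ n ih =>
      intro y hy hyn
      rcases le_or_gt ‖y‖ 2 with h | h
      · exact hA y hy h
      · have h1 := ih _ (hS y hy) (by rw [norm_mul, hpn]; rwa [pow_succ, mul_assoc] at hyn)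
        rw [eulerProd_eq_mul hp0 hp1, norm_mul]
        nlinarith [hbig y h, norm_nonneg (eulerProd p (p * y))]
  have hB' : ∀ y ∈ S, c ^ N / 2 ≤ ‖eulerProd p y‖ := fun y hy => by
    have ht : Tendsto (fun n : ℕ => p ^ n * ‖y‖) atTop (𝓝 (0 * ‖y‖)) :=
      (tendsto_pow_atTop_nhds_zero_of_lt_one hp0.le hp1).mul_const _
    obtain ⟨n, hn⟩ := (ht.eventually (eventually_le_nhds (by simp : 0 * ‖y‖ < 2))).exists
    exact hB n y hy hn
  -- The divisor 3 serves both cases: 1 + ‖y‖ ≤ 3 when ‖y‖ ≤ 2, and ‖y‖ - 1 ≥ (1 + ‖y‖)/3 when ‖y‖ >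
  -- 2.
  set d := min c 1 / 3 with hd
  have hd0 : 0 < d := by positivity
  have hC : ∀ y ∈ S, d * (1 + ‖y‖) ≤ ‖1 + y‖ := fun y hy => by
    rcases le_or_gt ‖y‖ 2 with h | h
    · have := min_le_left c 1
      nlinarith [hSc y hy]
    · have := min_le_right c 1
      nlinarith [hbig y h]
  refine ⟨d * (d * p) * (c ^ N / 2), by positivity, fun y hy => ?_⟩
  have h1 := hC y hy
  have h2 : d * p * (1 + ‖y‖) ≤ ‖1 + p * y‖ := by
    refine le_trans ?_ (hC _ (hS y hy))
    rw [norm_mul, hpn, mul_assoc]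
    gcongr
    nlinarith
  have h3 := hB' _ (hSn 2 y hy)
  have e : eulerProd p y = (1 + y) * (1 + p * y) * eulerProd p (p ^ 2 * y) := by
    rw [eulerProd_eq_prod_mul hp0 hp1 y 2]
    simp [Finset.prod_range_succ]
  rw [e, norm_mul, norm_mul]
  calc d * (d * p) * (c ^ N / 2) * (1 + ‖y‖ ^ 2)
      ≤ d * (d * p) * (c ^ N / 2) * (1 + ‖y‖) ^ 2 := by
        gcongr
        nlinarith [norm_nonneg y]
    _ = d * (1 + ‖y‖) * (d * p * (1 + ‖y‖)) * (c ^ N / 2) := by ring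
    _ ≤ _ := by gcongr

/-- A lower bound for the Theta function on sets on which both `y` and `p / y` stay away
from `-1`. -/
lemma exists_thetaFn_lower_bound {p : ℝ} (hp0 : 0 < p) (hp1 : p < 1) {S : Set ℂ}
    (hS : ∀ y ∈ S, (p : ℂ) * y ∈ S) (hSinv : ∀ y ∈ S, y⁻¹ ∈ S) (hS0 : ∀ y ∈ S, y ≠ 0)
    {c : ℝ} (hc : 0 < c) (hSc : ∀ y ∈ S, c ≤ ‖1 + y‖) :
    ∃ m > 0, ∀ y ∈ S, m * (1 + ‖y‖ ^ 2) ≤ ‖thetaFn p y‖ := by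
  obtain ⟨m, hm, h⟩ := exists_eulerProd_lower_bound hp0 hp1 hS hc hSc
  have h0 : 0 < ‖eulerProd p (-p)‖ := norm_pos_iff.2 (eulerProd_neg_ne_zero hp0 hp1
    (by rw [norm_neg]; exact norm_p_lt_one hp0 hp1))
  refine ⟨‖eulerProd p (-p)‖ * m * m, by positivity, fun y hy => ?_⟩
  have h1 := h y hy
  have h2 := h _ (hS _ (hSinv y hy))
  rw [thetaFn_eq_eulerProd hp0 hp1 (hS0 y hy), norm_mul, norm_mul, div_eq_mul_inv]
  have h3 : m ≤ ‖eulerProd p (p * y⁻¹)‖ := le_trans (by nlinarith [sq_nonneg ‖(p : ℂ) * y⁻¹‖]) h2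
  calc ‖eulerProd p (-p)‖ * m * m * (1 + ‖y‖ ^ 2)
      = ‖eulerProd p (-p)‖ * (m * (1 + ‖y‖ ^ 2)) * m := by ring
    _ ≤ _ := by gcongr

/-! ### From base q to base p; the Borel transforms and their unique continuations. -/

lemma qInt_succ_eq {q : ℝ} (hq : 1 < q) (n : ℕ) :
    qInt q (n + 1) = q ^ n * (1 - q⁻¹ ^ (n + 1)) / (1 - q⁻¹) := by
  have h0 : q ≠ 0 := by positivity
  have h1 : q - 1 ≠ 0 := (sub_pos.2 hq).ne'
  have h2 : 1 - q⁻¹ = (q - 1) / q := by field_simp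
  rw [qInt, geom_sum_eq hq.ne', h2, inv_pow, pow_succ]
  field_simp

lemma one_sub_inv_pos {q : ℝ} (hq : 1 < q) : 0 < 1 - q⁻¹ := sub_pos.2 (inv_lt_one_of_one_lt₀ hq)

lemma one_sub_inv_ne_zero {q : ℝ} (hq : 1 < q) : (1 - (q : ℂ)⁻¹) ≠ 0 := by
  exact_mod_cast (one_sub_inv_pos hq).ne'

/-- The power of q split off here is exactly the one that B_q divides by, which leaves the
coefficients (p; p)_n. -/
lemma qFact_eq {q : ℝ} (hq : 1 < q) (n : ℕ) :
    qFact q n = q ^ (n * (n - 1) / 2) * qPoch q⁻¹ n / (1 - q⁻¹) ^ n := by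
  induction n with
  | zero => simp [qFact, qPoch]
  | succ n ih =>
    have h := (one_sub_inv_pos hq).ne'
    rw [qFact, Finset.prod_range_succ, ← qFact, ih, qInt_succ_eq hq, qPoch_succ, Nat.triangle_succ,
      pow_add, pow_succ (1 - q⁻¹), div_mul_div_comm]
    ring

lemma qFact_cast_eq {q : ℝ} (hq : 1 < q) (n : ℕ) :
    (qFact q n : ℂ) = (q : ℂ) ^ (n * (n - 1) / 2) * (qPoch q⁻¹ n : ℂ) / (1 - (q : ℂ)⁻¹) ^ n := by
  rw [qFact_eq hq]
  push_cast
  rfl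

lemma qExp_eq_eulerProd {q : ℝ} (hq : 1 < q) (x : ℂ) :
    qExp q x = eulerProd q⁻¹ ((1 - (q : ℂ)⁻¹) * x) := by
  refine tsum_congr fun n => ?_
  have h0 : (q : ℂ) ≠ 0 := by exact_mod_cast (zero_lt_one.trans hq).ne'
  have h1 := one_sub_inv_ne_zero hq
  have h2 := qPoch_ne_zero (inv_pos.2 (zero_lt_one.trans hq)) (inv_lt_one_of_one_lt₀ hq) n
  rw [qFact_cast_eq hq, eulerCoeff, mul_pow, Complex.ofReal_inv, inv_pow]
  field_simp

lemma qFact_ne_zero {q : ℝ} (hq : 1 < q) (n : ℕ) : (qFact q n : ℂ) ≠ 0 := by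
  have h0 : (q : ℂ) ≠ 0 := by exact_mod_cast (zero_lt_one.trans hq).ne'
  have h1 := one_sub_inv_ne_zero hq
  have h2 := qPoch_ne_zero (inv_pos.2 (zero_lt_one.trans hq)) (inv_lt_one_of_one_lt₀ hq) n
  rw [qFact_cast_eq hq]
  positivity

lemma coeff_formalBorelFact {q : ℝ} (hq : 1 < q) (n : ℕ) :
    PowerSeries.coeff n (formalBorelFact q (qEulerSeries q)) = (-1) ^ n := by
  rw [formalBorelFact, qEulerSeries, PowerSeries.coeff_mk, PowerSeries.coeff_succ_X_mul,
    PowerSeries.coeff_mk, mul_div_cancel_right₀ _ (qFact_ne_zero hq n)]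

lemma coeff_formalBorelTheta {q : ℝ} (hq : 1 < q) (n : ℕ) :
    PowerSeries.coeff n (formalBorelTheta q (qEulerSeries q)) =
      (qPoch q⁻¹ n : ℂ) * (-(1 - (q : ℂ)⁻¹)⁻¹) ^ n := by
  have h0 : (q : ℂ) ≠ 0 := by exact_mod_cast (zero_lt_one.trans hq).ne'
  have h1 := one_sub_inv_ne_zero hq
  rw [formalBorelTheta, qEulerSeries, PowerSeries.coeff_mk, PowerSeries.coeff_succ_X_mul,
    PowerSeries.coeff_mk, qFact_cast_eq hq, neg_pow (1 - (q : ℂ)⁻¹)⁻¹, inv_pow]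
  field_simp

/-- The analytic continuation of `B_q` of the `q`-Euler series. -/
def borelSum (q : ℝ) (ξ : ℂ) : ℂ := mittagLeffler q⁻¹ (-(1 - (q : ℂ)⁻¹)⁻¹ * ξ)

/-- The complement of the poles of `borelSum`. -/
def borelDomain (q : ℝ) : Set ℂ := {ξ : ℂ | ∀ n : ℕ, ξ ≠ ((q : ℂ)⁻¹ - 1) * (q : ℂ) ^ n}

lemma borelDomain_iff {q : ℝ} (hq : 1 < q) (ξ : ℂ) : ξ ∈ borelDomain q ↔
    ∀ k : ℕ, 1 - -(1 - (q : ℂ)⁻¹)⁻¹ * ξ * ((q⁻¹ : ℝ) : ℂ) ^ k ≠ 0 := by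
  have h0 : (q : ℂ) ≠ 0 := by exact_mod_cast (zero_lt_one.trans hq).ne'
  have h1 := one_sub_inv_ne_zero hq
  refine forall_congr' fun k => not_congr ?_
  have e : 1 - -(1 - (q : ℂ)⁻¹)⁻¹ * ξ * ((q⁻¹ : ℝ) : ℂ) ^ k =
      (1 - (q : ℂ)⁻¹)⁻¹ * ((q : ℂ) ^ k)⁻¹ * (ξ - ((q : ℂ)⁻¹ - 1) * (q : ℂ) ^ k) := by
    rw [Complex.ofReal_inv, inv_pow]
    have h2 : (q : ℂ) ^ k ≠ 0 := pow_ne_zero _ h0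
    generalize (q : ℂ) ^ k = Q at h2 ⊢
    obtain ⟨t, ht⟩ : ∃ t, 1 - (q : ℂ)⁻¹ = t := ⟨_, rfl⟩
    have ht' : (q : ℂ)⁻¹ - 1 = -t := by rw [← ht]; ring
    rw [ht] at h1
    rw [ht', ht]
    field_simp
    ring
  rw [e, mul_eq_zero, sub_eq_zero]
  have : (1 - (q : ℂ)⁻¹)⁻¹ * ((q : ℂ) ^ k)⁻¹ ≠ 0 :=
    mul_ne_zero (inv_ne_zero h1) (inv_ne_zero (pow_ne_zero _ h0))
  simp [this]

lemma differentiableAt_borelSum {q : ℝ} (hq : 1 < q) {ξ : ℂ} (hξ : ξ ∈ borelDomain q) :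
    DifferentiableAt ℂ (borelSum q) ξ := by
  have h := differentiableAt_mittagLeffler (inv_pos.2 (zero_lt_one.trans hq))
    (inv_lt_one_of_one_lt₀ hq) ((borelDomain_iff hq ξ).1 hξ)
  exact DifferentiableAt.comp ξ (f := fun ξ => -(1 - (q : ℂ)⁻¹)⁻¹ * ξ) h (by fun_prop)

lemma isContinuation_borelSum {q : ℝ} (hq : 1 < q) :
    IsContinuationOfSeries (formalBorelTheta q (qEulerSeries q)) (borelDomain q) (borelSum q) := by
  refine ⟨?_, fun ξ hξ => (differentiableAt_borelSum hq hξ).differentiableWithinAt⟩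
  have ht : Tendsto (fun ξ : ℂ => ‖-(1 - (q : ℂ)⁻¹)⁻¹ * ξ‖) (𝓝 0) (𝓝 0) := by
    have : Continuous fun ξ : ℂ => ‖-(1 - (q : ℂ)⁻¹)⁻¹ * ξ‖ := by fun_prop
    simpa using this.tendsto 0
  filter_upwards [ht.eventually (eventually_lt_nhds one_pos)] with ξ hξ
  refine (hasSum_mittagLeffler (inv_pos.2 (zero_lt_one.trans hq))
    (inv_lt_one_of_one_lt₀ hq) hξ).congr_fun fun n => ?_
  rw [coeff_formalBorelTheta hq, mul_pow, mul_assoc]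

lemma isContinuation_geometric {q : ℝ} (hq : 1 < q) :
    IsContinuationOfSeries (formalBorelFact q (qEulerSeries q)) {-1}ᶜ
      (fun ξ => 1 / (1 + ξ)) := by
  constructor
  · filter_upwards [Metric.ball_mem_nhds (0 : ℂ) one_pos] with ξ hξ
    have h := hasSum_geometric_of_norm_lt_one (ξ := -ξ) (by simpa using hξ)
    rw [sub_neg_eq_add, ← one_div] at h
    refine h.congr_fun fun n => ?_
    rw [coeff_formalBorelFact hq, neg_pow ξ]
  · refine DifferentiableOn.div (by fun_prop) (by fun_prop) fun ξ hξ h => hξ ?_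
    rw [mem_singleton_iff]
    linear_combination h

/-- By the identity theorem an arbitrary continuation may be replaced by the explicit one. -/
lemma IsContinuationOfSeries.eqOn {S : PowerSeries ℂ} {U : Set ℂ} {g g' : ℂ → ℂ}
    (hU : IsOpen U) (hUc : IsPreconnected U) (h0 : (0 : ℂ) ∈ U)
    (hg : IsContinuationOfSeries S U g) (hg' : IsContinuationOfSeries S U g') : EqOn g g' U := by
  refine (hg.2.analyticOnNhd hU).eqOn_of_preconnected_of_eventuallyEq
    (hg'.2.analyticOnNhd hU) hUc h0 ?_
  filter_upwards [hg.1, hg'.1] with ξ h1 h2 using h1.unique h2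

lemma isOpen_borelDomain {q : ℝ} (hq : 1 < q) : IsOpen (borelDomain q) := by
  have hp0 : 0 < q⁻¹ := inv_pos.2 (zero_lt_one.trans hq)
  have hp1 : q⁻¹ < 1 := inv_lt_one_of_one_lt₀ hq
  have hU : IsOpen {u : ℂ | ∀ k : ℕ, 1 - u * ((q⁻¹ : ℝ) : ℂ) ^ k ≠ 0} := by
    rw [Metric.isOpen_iff]
    intro u hu
    obtain ⟨δ, hδ, h⟩ := exists_le_norm_one_sub hp0 hp1 hu
    refine ⟨δ, hδ, fun w hw k hk => ?_⟩
    have h2 : 1 - u * ((q⁻¹ : ℝ) : ℂ) ^ k = (w - u) * ((q⁻¹ : ℝ) : ℂ) ^ k := by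
      linear_combination hk
    have h3 := h k
    rw [mem_ball_iff_norm] at hw
    rw [h2, norm_mul, norm_pow, Complex.norm_of_nonneg hp0.le] at h3
    exact absurd (h3.trans (mul_le_of_le_one_right (norm_nonneg _) (pow_le_one₀ hp0.le hp1.le)))
      hw.not_ge
  have : borelDomain q = (fun ξ : ℂ => -(1 - (q : ℂ)⁻¹)⁻¹ * ξ) ⁻¹'
      {u : ℂ | ∀ k : ℕ, 1 - u * ((q⁻¹ : ℝ) : ℂ) ^ k ≠ 0} := by
    ext ξ
    exact borelDomain_iff hq ξ
  rw [this]
  exact hU.preimage (by fun_prop)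

/-- The complement of a countable set in the plane is connected. -/
lemma isPreconnected_borelDomain (q : ℝ) : IsPreconnected (borelDomain q) := by
  have : borelDomain q = (range fun n : ℕ => ((q : ℂ)⁻¹ - 1) * (q : ℂ) ^ n)ᶜ := by
    ext ξ
    simp [borelDomain, eq_comm]
  rw [this]
  exact ((countable_range _).isConnected_compl_of_one_lt_rank
    (by rw [Complex.rank_real_complex]; exact Cardinal.one_lt_two)).isPreconnected

lemma zero_mem_borelDomain {q : ℝ} (hq : 1 < q) : (0 : ℂ) ∈ borelDomain q := by
  rw [borelDomain_iff hq]
  simp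

lemma eqOn_borelSum {q : ℝ} (hq : 1 < q) {φ : ℂ → ℂ}
    (hφ : IsContinuationOfSeries (formalBorelTheta q (qEulerSeries q)) (borelDomain q) φ) :
    EqOn φ (borelSum q) (borelDomain q) :=
  hφ.eqOn (isOpen_borelDomain hq) (isPreconnected_borelDomain q) (zero_mem_borelDomain hq)
    (isContinuation_borelSum hq)

lemma eqOn_geometric {q : ℝ} (hq : 1 < q) {ψ : ℂ → ℂ}
    (hψ : IsContinuationOfSeries (formalBorelFact q (qEulerSeries q)) {-1}ᶜ ψ) :
    EqOn ψ (fun ξ => 1 / (1 + ξ)) {-1}ᶜ :=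
  hψ.eqOn isOpen_compl_singleton (isConnected_compl_singleton_of_one_lt_rank
    (by rw [Complex.rank_real_complex]; exact Cardinal.one_lt_two) _).isPreconnected (by simp)
    (isContinuation_geometric hq)

/-! ### Bounds on closed sectors. -/

/-- The closed sector `|arg y| ≤ a`, without its vertex. -/
def closedSector (a : ℝ) : Set ℂ := Complex.exp '' {w | |w.im| ≤ a}

lemma pos_mul_exp_mem_closedSector {a t : ℝ} (ht : 0 < t) {w : ℂ} (hw : |w.im| ≤ a) :
    (t : ℂ) * Complex.exp w ∈ closedSector a :=
  ⟨Real.log t + w, by simpa using hw, by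
    rw [Complex.exp_add, ← Complex.ofReal_exp, Real.exp_log ht]⟩

lemma pos_mul_mem_closedSector {a t : ℝ} (ht : 0 < t) {y : ℂ} (hy : y ∈ closedSector a) :
    (t : ℂ) * y ∈ closedSector a := by
  obtain ⟨w, hw, rfl⟩ := hy
  exact pos_mul_exp_mem_closedSector ht hw

lemma inv_mem_closedSector {a : ℝ} {y : ℂ} (hy : y ∈ closedSector a) : y⁻¹ ∈ closedSector a := by
  obtain ⟨w, hw, rfl⟩ := hy
  exact ⟨-w, by simpa using hw, Complex.exp_neg w⟩

lemma ne_zero_of_mem_closedSector {a : ℝ} {y : ℂ} (hy : y ∈ closedSector a) : y ≠ 0 := by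
  obtain ⟨w, -, rfl⟩ := hy
  exact Complex.exp_ne_zero w

lemma exists_le_norm_one_add_of_mem_closedSector {a : ℝ} (ha : a < π) :
    ∃ c > 0, ∀ y ∈ closedSector a, c ≤ ‖1 + y‖ := by
  rcases lt_or_ge a 0 with h0 | h0
  · refine ⟨1, one_pos, ?_⟩
    rintro _ ⟨w, hw, rfl⟩
    exact absurd (le_trans (abs_nonneg _) hw) h0.not_ge
  -- With r = |y| and θ = arg y, |1 + y|² = (1+r)² cos²(θ/2) + (1-r)² sin²(θ/2) ≥ cos²(θ/2), so
  -- cos(a/2) serves as the constant.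
  have hc : 0 < Real.cos (a / 2) := Real.cos_pos_of_mem_Ioo ⟨by linarith, by linarith⟩
  refine ⟨_, hc, ?_⟩
  rintro _ ⟨w, hw, rfl⟩
  have hw' : |w.im| ≤ a := hw
  set r := Real.exp w.re with hr
  have hr0 : 0 < r := Real.exp_pos _
  have h1 : Real.cos (a / 2) ≤ Real.cos (w.im / 2) := by
    rw [← Real.cos_abs (w.im / 2)]
    apply Real.cos_le_cos_of_nonneg_of_le_pi (abs_nonneg _) (by linarith)
    rw [abs_div, abs_two]
    linarith
  have h2 : Real.cos w.im = 2 * Real.cos (w.im / 2) ^ 2 - 1 := by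
    rw [← Real.cos_two_mul]
    ring_nf
  have h3 : ‖1 + Complex.exp w‖ ^ 2 = (1 + r * Real.cos w.im) ^ 2 + (r * Real.sin w.im) ^ 2 := by
    rw [← Complex.normSq_eq_norm_sq, Complex.normSq_apply]
    simp only [Complex.add_re, Complex.add_im, Complex.exp_re, Complex.exp_im, Complex.one_re,
      Complex.one_im, zero_add, ← hr]
    ring
  refine abs_le_of_sq_le_sq' ?_ (norm_nonneg _) |>.2
  rw [h3]
  have h4 := Real.sin_sq_add_cos_sq w.im
  have h5 : (1 + r * Real.cos w.im) ^ 2 + (r * Real.sin w.im) ^ 2 =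
      1 + 2 * r * Real.cos w.im + r ^ 2 := by linear_combination r ^ 2 * h4
  have h6 : Real.cos (w.im / 2) ^ 2 ≤ 1 := Real.cos_sq_le_one _
  have h7 : Real.cos (a / 2) ^ 2 ≤ Real.cos (w.im / 2) ^ 2 := by gcongr
  rw [h5, h2]
  nlinarith [mul_nonneg (sq_nonneg (1 - r)) (sub_nonneg.2 h6), mul_pos hr0 hr0,
    sq_nonneg (Real.cos (w.im / 2)), mul_nonneg hr0.le (sq_nonneg (Real.cos (w.im / 2))),
    mul_nonneg (sq_nonneg r) (sq_nonneg (Real.cos (w.im / 2)))]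

lemma eulerProd_lower_bound_closedSector {p : ℝ} (hp0 : 0 < p) (hp1 : p < 1) {a : ℝ} (ha : a < π) :
    ∃ m > 0, ∀ y ∈ closedSector a, m * (1 + ‖y‖ ^ 2) ≤ ‖eulerProd p y‖ := by
  obtain ⟨c, hc, h⟩ := exists_le_norm_one_add_of_mem_closedSector ha
  exact exists_eulerProd_lower_bound hp0 hp1 (fun y hy => pos_mul_mem_closedSector hp0 hy) hc h

lemma thetaFn_lower_bound_closedSector {p : ℝ} (hp0 : 0 < p) (hp1 : p < 1) {a : ℝ} (ha : a < π) :
    ∃ m > 0, ∀ y ∈ closedSector a, m * (1 + ‖y‖ ^ 2) ≤ ‖thetaFn p y‖ := by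
  obtain ⟨c, hc, h⟩ := exists_le_norm_one_add_of_mem_closedSector ha
  exact exists_thetaFn_lower_bound hp0 hp1 (fun y hy => pos_mul_mem_closedSector hp0 hy)
    (fun y hy => inv_mem_closedSector hy) (fun y hy => ne_zero_of_mem_closedSector hy) hc h

/-! ### Holomorphy of the Laplace integral and independence of the direction. -/

lemma integrableOn_lorentz (M : ℝ) {ε : ℝ} (hε : 0 < ε) :
    IntegrableOn (fun t : ℝ => M * (1 + (ε * t) ^ 2)⁻¹) (Ioi 0) :=
  ((integrable_inv_one_add_sq.comp_mul_left' hε.ne').const_mul M).integrableOn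

lemma integrableOn_of_norm_le_lorentz {f : ℝ → ℂ} (hf : ContinuousOn f (Ioi 0)) {M ε : ℝ}
    (hε : 0 < ε) (h : ∀ t, 0 < t → ‖f t‖ ≤ M * (1 + (ε * t) ^ 2)⁻¹) : IntegrableOn f (Ioi 0) :=
  (integrableOn_lorentz M hε).mono' (hf.aestronglyMeasurable measurableSet_Ioi)
    ((ae_restrict_iff' measurableSet_Ioi).2 (Eventually.of_forall fun t ht => h t ht))

/-- The integral of a holomorphic family is holomorphic if the family is locally dominated. -/
lemma differentiableOn_integral_of_dominated {X : Type*} [MeasurableSpace X] {μ : Measure X}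
    {U : Set ℂ} {K : X → ℂ → ℂ} (hmeas : ∀ w, AEStronglyMeasurable (K · w) μ)
    (hdiff : ∀ᵐ t ∂μ, ∀ w ∈ U, DifferentiableAt ℂ (K t) w)
    (hbound : ∀ w₀ ∈ U, ∃ r > 0, Metric.ball w₀ r ⊆ U ∧ ∃ B : X → ℝ, Integrable B μ ∧
      ∀ᵐ t ∂μ, ∀ w ∈ Metric.ball w₀ r, ‖K t w‖ ≤ B t) :
    DifferentiableOn ℂ (fun w => ∫ t, K t w ∂μ) U := by
  intro w₀ hw₀
  obtain ⟨r, hr, hrU, B, hB, hKB⟩ := hbound w₀ hw₀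
  -- The derivative is measurable in t as a limit of difference quotients with steps 1/(n+1).
  have hmeas' : AEStronglyMeasurable (fun t => deriv (K t) w₀) μ := by
    have hu : Tendsto (fun n : ℕ => ((n : ℂ) + 1)⁻¹) atTop (𝓝[≠] 0) := by
      refine tendsto_nhdsWithin_iff.2 ⟨?_, Eventually.of_forall fun n => ?_⟩
      · simpa using tendsto_one_div_add_atTop_nhds_zero_nat (𝕜 := ℂ)
      · exact inv_ne_zero (Nat.cast_add_one_ne_zero n)
    refine aestronglyMeasurable_of_tendsto_ae (u := atTop)
      (f := fun (n : ℕ) t => ((n : ℂ) + 1)⁻¹⁻¹ • (K t (w₀ + ((n : ℂ) + 1)⁻¹) - K t w₀))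
      (fun n => AEStronglyMeasurable.const_smul ((hmeas (w₀ + ((n : ℂ) + 1)⁻¹)).sub (hmeas w₀))
        ((n : ℂ) + 1)⁻¹⁻¹) ?_
    filter_upwards [hdiff] with t ht
    exact ((ht w₀ hw₀).hasDerivAt.tendsto_slope_zero).comp hu
  have h := hasDerivAt_integral_of_dominated_loc_of_deriv_le (μ := μ) (𝕜 := ℂ)
    (F := fun w t => K t w) (F' := fun w t => deriv (K t) w) (x₀ := w₀)
    (s := Metric.ball w₀ (r / 2)) (bound := fun t => B t / (r / 2))
    (Metric.ball_mem_nhds w₀ (half_pos hr)) (Eventually.of_forall hmeas)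
    (hB.mono' (hmeas w₀) (hKB.mono fun t ht => ht w₀ (Metric.mem_ball_self hr))) hmeas' ?_
    (hB.div_const _) ?_
  · exact h.2.differentiableAt.differentiableWithinAt
  · filter_upwards [hdiff, hKB] with t ht htB w hw
    have hsub : Metric.closedBall w (r / 2) ⊆ Metric.ball w₀ r := fun v hv => by
      rw [Metric.mem_ball] at hw ⊢
      rw [Metric.mem_closedBall] at hv
      linarith [dist_triangle v w w₀]
    -- Cauchy's estimate on circles of radius r/2 turns the bound on the family into one on its
    -- derivative.
    refine Complex.norm_deriv_le_of_forall_mem_sphere_norm_le (half_pos hr) ?_ fun v hv =>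
      htB v (hsub (Metric.sphere_subset_closedBall hv))
    refine DifferentiableOn.diffContOnCl fun v hv => ?_
    exact (ht v (hrU (hsub (Metric.closure_ball_subset_closedBall hv)))).differentiableWithinAt
  · filter_upwards [hdiff] with t ht w hw
    exact (ht w (hrU (Metric.ball_subset_ball (half_le_self hr.le) hw))).hasDerivAt

/-- The integrand of the Laplace transform with kernel `e_q`, with both the direction and the
variable in logarithmic coordinates. -/
def expCore (p C : ℝ) (a b : ℂ) (t : ℝ) : ℂ :=
  Complex.exp a / (1 + t * Complex.exp a) / eulerProd p (C * t * Complex.exp b)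

/-- The constants are uniform over a box of (α, β), as dominated differentiation in these parameters
requires. -/
lemma exists_expCore_bound {p : ℝ} (hp0 : 0 < p) (hp1 : p < 1) {C : ℝ} (hC : 0 < C) {a : ℝ}
    (ha : a < π) (R : ℝ) : ∃ M, ∃ ε > 0, ∀ α β : ℂ, |α.im| ≤ a → |β.im| ≤ a → |α.re| ≤ R →
      |β.re| ≤ R → ∀ t : ℝ, 0 < t → ‖expCore p C α β t‖ ≤ M * (1 + (ε * t) ^ 2)⁻¹ := by
  obtain ⟨c, hc, h⟩ := exists_le_norm_one_add_of_mem_closedSector ha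
  obtain ⟨m, hm, hP⟩ := eulerProd_lower_bound_closedSector hp0 hp1 ha
  refine ⟨Real.exp R / c / m, C * Real.exp (-R), by positivity, fun α β hα hβ hαR hβR t ht => ?_⟩
  have h1 := h _ (pos_mul_exp_mem_closedSector ht hα)
  have h2 := hP _ (pos_mul_exp_mem_closedSector (mul_pos hC ht) hβ)
  rw [norm_mul, Complex.norm_of_nonneg (mul_pos hC ht).le, Complex.norm_exp] at h2
  push_cast at h2
  have h3 : m * (1 + (C * Real.exp (-R) * t) ^ 2) ≤ ‖eulerProd p (C * t * Complex.exp β)‖ := by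
    refine le_trans ?_ h2
    have : Real.exp (-R) ≤ Real.exp β.re := Real.exp_le_exp.2 (abs_le.1 hβR).1
    have e : C * Real.exp (-R) * t = C * t * Real.exp (-R) := by ring
    rw [e]
    gcongr
  rw [expCore, norm_div, norm_div, Complex.norm_exp, ← div_eq_mul_inv, div_div _ m]
  have h4 : Real.exp α.re ≤ Real.exp R := Real.exp_le_exp.2 (abs_le.1 hαR).2
  gcongr

lemma one_add_ne_zero_of_mem_closedSector {a : ℝ} (ha : a < π) {y : ℂ} (hy : y ∈ closedSector a) :
    1 + y ≠ 0 := by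
  obtain ⟨c, hc, h⟩ := exists_le_norm_one_add_of_mem_closedSector ha
  exact norm_pos_iff.1 (hc.trans_le (h y hy))

lemma eulerProd_ne_zero_of_mem_closedSector {p : ℝ} (hp0 : 0 < p) (hp1 : p < 1) {a : ℝ}
    (ha : a < π) {y : ℂ} (hy : y ∈ closedSector a) : eulerProd p y ≠ 0 := by
  obtain ⟨m, hm, h⟩ := eulerProd_lower_bound_closedSector hp0 hp1 ha
  exact norm_pos_iff.1 (lt_of_lt_of_le (by positivity) (h y hy))

lemma thetaFn_ne_zero_of_mem_closedSector {p : ℝ} (hp0 : 0 < p) (hp1 : p < 1) {a : ℝ}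
    (ha : a < π) {y : ℂ} (hy : y ∈ closedSector a) : thetaFn p y ≠ 0 := by
  obtain ⟨m, hm, h⟩ := thetaFn_lower_bound_closedSector hp0 hp1 ha
  exact norm_pos_iff.1 (lt_of_lt_of_le (by positivity) (h y hy))

lemma continuousOn_expCore {p : ℝ} (hp0 : 0 < p) (hp1 : p < 1) {C : ℝ} (hC : 0 < C) {α β : ℂ}
    (hα : |α.im| < π) (hβ : |β.im| < π) : ContinuousOn (expCore p C α β) (Ioi 0) := by
  have hP := (differentiable_eulerProd hp0 hp1).continuous
  refine ContinuousOn.div (ContinuousOn.div (by fun_prop) (by fun_prop) fun t ht => ?_)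
    (Continuous.continuousOn (by fun_prop)) fun t ht => ?_
  · exact one_add_ne_zero_of_mem_closedSector hα (pos_mul_exp_mem_closedSector ht le_rfl)
  · have := pos_mul_exp_mem_closedSector (mul_pos hC ht) (le_refl |β.im|)
    push_cast at this
    exact eulerProd_ne_zero_of_mem_closedSector hp0 hp1 hβ this

lemma measurable_expCore {p : ℝ} (hp0 : 0 < p) (hp1 : p < 1) (C : ℝ) (α β : ℂ) :
    Measurable (expCore p C α β) := by
  have hP := (differentiable_eulerProd hp0 hp1).continuous
  exact Measurable.div (Measurable.div (by fun_prop) (by fun_prop))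
    (Continuous.measurable (by fun_prop))

lemma integrableOn_expCore {p : ℝ} (hp0 : 0 < p) (hp1 : p < 1) {C : ℝ} (hC : 0 < C) {α β : ℂ}
    (hα : |α.im| < π) (hβ : |β.im| < π) : IntegrableOn (expCore p C α β) (Ioi 0) := by
  obtain ⟨M, ε, hε, h⟩ := exists_expCore_bound hp0 hp1 hC (max_lt hα hβ) (max |α.re| |β.re|)
  exact integrableOn_of_norm_le_lorentz (continuousOn_expCore hp0 hp1 hC hα hβ) hε
    (h α β (le_max_left _ _) (le_max_right _ _) (le_max_left _ _) (le_max_right _ _))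

/-- The Laplace transform with kernel `e_q`, with both the direction and the variable in
logarithmic coordinates. -/
def expLaplace (p C : ℝ) (a b : ℂ) : ℂ := ∫ t in Ioi (0 : ℝ), expCore p C a b t

lemma differentiableOn_expLaplace {p : ℝ} (hp0 : 0 < p) (hp1 : p < 1) {C : ℝ} (hC : 0 < C)
    {f g : ℂ → ℂ} (hf : Differentiable ℂ f) (hg : Differentiable ℂ g) :
    DifferentiableOn ℂ (fun w => expLaplace p C (f w) (g w))
      {w | |(f w).im| < π ∧ |(g w).im| < π} := by
  have hfc := hf.continuous
  have hgc := hg.continuous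
  refine differentiableOn_integral_of_dominated
    (fun w => (measurable_expCore hp0 hp1 C _ _).aestronglyMeasurable) ?_ ?_
  · refine (ae_restrict_iff' measurableSet_Ioi).2 (Eventually.of_forall fun t ht w hw => ?_)
    have h2 := pos_mul_exp_mem_closedSector (mul_pos hC ht) (le_refl |(g w).im|)
    push_cast at h2
    have hP := differentiable_eulerProd hp0 hp1
    refine DifferentiableAt.div (DifferentiableAt.div (by fun_prop) (by fun_prop) ?_)
      (by fun_prop) ?_
    · exact one_add_ne_zero_of_mem_closedSector hw.1 (pos_mul_exp_mem_closedSector ht le_rfl)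
    · exact eulerProd_ne_zero_of_mem_closedSector hp0 hp1 hw.2 h2
  · rintro w₀ ⟨h1, h2⟩
    obtain ⟨a, ha1, ha⟩ := exists_between (max_lt h1 h2)
    obtain ⟨R, hR⟩ := exists_gt (max |(f w₀).re| |(g w₀).re|)
    rw [max_lt_iff] at ha1 hR
    have hev : ∀ᶠ w in 𝓝 w₀, (|(f w).im| < a ∧ |(g w).im| < a) ∧ |(f w).re| < R ∧ |(g w).re| < R := by
      have hlt : ∀ {h : ℂ → ℝ} {b : ℝ}, Continuous h → h w₀ < b → ∀ᶠ w in 𝓝 w₀, h w < b :=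
        fun hc hb => hc.continuousAt.eventually_lt continuousAt_const hb
      exact ((hlt (by fun_prop) ha1.1).and (hlt (by fun_prop) ha1.2)).and
        ((hlt (by fun_prop) hR.1).and (hlt (by fun_prop) hR.2))
    obtain ⟨r, hr, hball⟩ := Metric.eventually_nhds_iff_ball.1 hev
    obtain ⟨M, ε, hε, h⟩ := exists_expCore_bound hp0 hp1 hC ha R
    refine ⟨r, hr, fun w hw => ?_, _, integrableOn_lorentz M hε, ?_⟩
    · obtain ⟨⟨h1, h2⟩, -⟩ := hball w hw
      exact ⟨h1.trans ha, h2.trans ha⟩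
    · refine (ae_restrict_iff' measurableSet_Ioi).2 (Eventually.of_forall fun t ht w hw => ?_)
      obtain ⟨⟨h1, h2⟩, h3, h4⟩ := hball w hw
      exact h _ _ h1.le h2.le h3.le h4.le t ht

/-- A real shift of both logarithms is the substitution t ↦ e^s t. -/
lemma expLaplace_add_real (p C : ℝ) (a b : ℂ) (s : ℝ) :
    expLaplace p C (a + s) (b + s) = expLaplace p C a b := by
  have h := integral_comp_mul_left_Ioi' (expCore p C a b) 0 (Real.exp_pos s)
  rw [mul_zero] at h
  rw [expLaplace, expLaplace, ← h, ← integral_smul]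
  refine integral_congr_ae (Eventually.of_forall fun t => ?_)
  simp only [expCore, Complex.exp_add, Complex.real_smul]
  push_cast
  ring_nf

/-- The Laplace transform does not depend on the direction of integration. -/
lemma expLaplace_eq_of_direction {p : ℝ} (hp0 : 0 < p) (hp1 : p < 1) {C : ℝ} (hC : 0 < C) {z w w' : ℂ}
    (hw : |w.im| < π ∧ |(w - z).im| < π) (hw' : |w'.im| < π ∧ |(w' - z).im| < π) :
    expLaplace p C w (w - z) = expLaplace p C w' (w' - z) := by
  have hd := differentiableOn_expLaplace hp0 hp1 hC (f := fun w => w) (g := fun w => w - z)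
    differentiable_id (by fun_prop)
  set U : Set ℂ := {w | |w.im| < π ∧ |(w - z).im| < π} with hU
  have hUo : IsOpen U := by
    have h1 : Continuous fun w : ℂ => |w.im| := by fun_prop
    have h2 : Continuous fun w : ℂ => |(w - z).im| := by fun_prop
    exact (isOpen_lt h1 continuous_const).inter (isOpen_lt h2 continuous_const)
  have hUc : Convex ℝ U := by
    have e : U = Complex.im ⁻¹' (Ioo (-π) π ∩ Ioo (z.im - π) (z.im + π)) := by
      ext v
      simp only [hU, mem_ofPred_eq, abs_lt, Complex.sub_im, mem_preimage, mem_inter_iff, mem_Ioo]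
      constructor <;> rintro ⟨⟨_, _⟩, _, _⟩ <;> refine ⟨⟨?_, ?_⟩, ?_, ?_⟩ <;> linarith
    rw [e]
    exact ((convex_Ioo _ _).inter (convex_Ioo _ _)).is_linear_preimage Complex.imLm.isLinear
  -- The complex derivative can be computed along the real direction, where the function is
  -- constant. This replaces a rotation of the contour and needs no arcs at infinity.
  refine hUo.is_const_of_deriv_eq_zero hUc.isPreconnected hd (fun v hv => ?_) hw hw'
  have h1 := (hd.differentiableAt (hUo.mem_nhds hv)).hasDerivAt
  rw [← add_zero v] at h1
  have h2 := (HasDerivAt.comp_const_add v 0 h1).comp_ofReal (z := 0)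
  have e : (fun s : ℝ => expLaplace p C (v + s) (v + s - z)) =
      fun _ => expLaplace p C v (v - z) := by
    funext s
    rw [add_sub_right_comm, expLaplace_add_real]
  rw [e, add_zero] at h2
  exact h2.unique (hasDerivAt_const _ _)

/-! ### Equality of the two continuous Laplace transforms. -/

/-- The substitution t ↦ c_k t in the k-th term preserves both its integral and its L¹ norm, so sum
and integral may be exchanged before and after it. -/
lemma integral_tsum_rescale {F : ℕ → ℝ → ℂ} {c : ℕ → ℝ} (hc : ∀ k, 0 < c k)
    (hF : ∀ k, IntegrableOn (F k) (Ioi 0))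
    (hsum : Summable fun k => ∫ t in Ioi (0 : ℝ), ‖F k t‖) :
    ∫ t in Ioi (0 : ℝ), ∑' k, F k t = ∫ t in Ioi (0 : ℝ), ∑' k, (c k : ℂ) * F k (c k * t) := by
  have hint : ∀ k, IntegrableOn (fun t => (c k : ℂ) * F k (c k * t)) (Ioi 0) := fun k =>
    ((integrableOn_Ioi_comp_mul_left_iff (F k) 0 (hc k)).2 (by simpa using hF k)).const_mul _
  have hnorm : ∀ k, ∫ t in Ioi (0 : ℝ), ‖(c k : ℂ) * F k (c k * t)‖ =
      ∫ t in Ioi (0 : ℝ), ‖F k t‖ := fun k => by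
    have h := integral_comp_mul_left_Ioi' (fun t => ‖F k t‖) 0 (hc k)
    rw [mul_zero] at h
    rw [← h, smul_eq_mul, ← integral_const_mul]
    simp [abs_of_pos (hc k)]
  have hval : ∀ k, ∫ t in Ioi (0 : ℝ), (c k : ℂ) * F k (c k * t) = ∫ t in Ioi (0 : ℝ), F k t :=
    fun k => by
      have h := integral_comp_mul_left_Ioi' (F k) 0 (hc k)
      rw [mul_zero] at h
      rw [← h, ← integral_smul]
      simp
  have h1 := hasSum_integral_of_summable_integral_norm hF hsum
  have h2 := hasSum_integral_of_summable_integral_norm hint (by simpa only [hnorm] using hsum)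
  simp only [hval] at h2
  exact h1.unique h2

lemma continuousOn_thetaFn {p : ℝ} (hp0 : 0 < p) (hp1 : p < 1) :
    ContinuousOn (thetaFn p) {0}ᶜ := by
  have hP := (differentiable_eulerProd hp0 hp1).continuous
  have hinv : ContinuousOn (fun y : ℂ => eulerProd p (p / y)) {0}ᶜ :=
    hP.comp_continuousOn (continuousOn_const.div continuousOn_id fun y hy => hy)
  refine (((continuousOn_const (c := eulerProd p (-p))).mul hP.continuousOn).mul hinv).congr fun y hy => ?_
  exact thetaFn_eq_eulerProd hp0 hp1 hy

/-- The `k`-th term of the expansion into partial fractions of the integrand of the Laplace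
transform with kernel `θ_p`, in logarithmic coordinates. -/
def thetaCore (p A Q : ℝ) (a b : ℂ) (k : ℕ) (t : ℝ) : ℂ :=
  eulerProd p (-p) * ((p : ℂ) ^ k / (qPoch p k : ℂ)) / (1 - -A * (t * Complex.exp a) * p ^ k) /
    thetaFn p (Q * (t * Complex.exp b)) * Complex.exp a

/-- This scale moves the k-th pole to a position independent of k; the remaining dependence on k is
that of `hasSum_inv_thetaFn`. -/
lemma rescale_thetaCore {p : ℝ} (hp0 : 0 < p) {A : ℝ} (hA : 0 < A) (Q : ℝ) (a b : ℂ)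
    (k : ℕ) (t : ℝ) :
    (((A * p ^ k)⁻¹ : ℝ) : ℂ) * thetaCore p A Q a b k ((A * p ^ k)⁻¹ * t) =
      (A : ℂ)⁻¹ * (Complex.exp a / (1 + t * Complex.exp a)) *
        (eulerProd p (-p) / (qPoch p k : ℂ) /
          thetaFn p (((Q * A⁻¹ : ℝ) : ℂ) * t * Complex.exp b / p ^ k)) := by
  have hp : (p : ℂ) ≠ 0 := Complex.ofReal_ne_zero.2 hp0.ne'
  have hA' : (A : ℂ) ≠ 0 := Complex.ofReal_ne_zero.2 hA.ne'
  have hpk : (p : ℂ) ^ k ≠ 0 := pow_ne_zero k hp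
  rw [thetaCore]
  push_cast
  have e1 : (1 : ℂ) - -A * (((A : ℂ) * (p : ℂ) ^ k)⁻¹ * t * Complex.exp a) * p ^ k =
      1 + t * Complex.exp a := by
    field_simp
    ring
  have e2 : (Q : ℂ) * (((A : ℂ) * (p : ℂ) ^ k)⁻¹ * t * Complex.exp b) =
      Q * (A : ℂ)⁻¹ * t * Complex.exp b / p ^ k := by
    field_simp
  rw [e1, e2]
  generalize thetaFn p _ = T
  generalize (1 : ℂ) + t * Complex.exp a = D
  field_simp

/-- The factor p^k only moves points along their ray in the sector, so M and ε do not depend on k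
and the summable weights control the series. -/
lemma exists_thetaCore_bound {p : ℝ} (hp0 : 0 < p) (hp1 : p < 1) {A Q : ℝ} (hA : 0 < A)
    (hQ : 0 < Q) {a b : ℂ} (ha : |a.im| < π) (hb : |b.im| < π) :
    ∃ M, ∃ ε > 0, ∀ k : ℕ, ∀ t : ℝ, 0 < t → ‖thetaCore p A Q a b k t‖ ≤
      ‖eulerProd p (-p) * ((p : ℂ) ^ k / (qPoch p k : ℂ))‖ * (M * (1 + (ε * t) ^ 2)⁻¹) := by
  obtain ⟨c, hc, h⟩ := exists_le_norm_one_add_of_mem_closedSector ha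
  obtain ⟨m, hm, hθ⟩ := thetaFn_lower_bound_closedSector hp0 hp1 hb
  refine ⟨Real.exp a.re / c / m, Q * Real.exp b.re, by positivity, fun k t ht => ?_⟩
  have h1 := h _ (pos_mul_exp_mem_closedSector (mul_pos (mul_pos hA ht) (pow_pos hp0 k)) le_rfl)
  have h2 := hθ _ (pos_mul_exp_mem_closedSector (mul_pos hQ ht) le_rfl)
  rw [norm_mul, Complex.norm_of_nonneg (mul_pos hQ ht).le, Complex.norm_exp] at h2
  push_cast at h1 h2
  have e1 : (1 : ℂ) - -A * (t * Complex.exp a) * p ^ k = 1 + A * t * p ^ k * Complex.exp a := by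
    ring
  have e2 : Q * Real.exp b.re * t = Q * t * Real.exp b.re := by ring
  rw [thetaCore, e1, ← mul_assoc (Q : ℂ), norm_mul, norm_div, norm_div, Complex.norm_exp, e2]
  set W := ‖eulerProd p (-p) * ((p : ℂ) ^ k / (qPoch p k : ℂ))‖
  calc _ ≤ W / c / (m * (1 + (Q * t * Real.exp b.re) ^ 2)) * Real.exp a.re := by gcongr
    _ = _ := by
      rw [← div_eq_mul_inv, div_div _ m]
      ring

lemma continuousOn_thetaCore {p : ℝ} (hp0 : 0 < p) (hp1 : p < 1) {A Q : ℝ} (hA : 0 < A)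
    (hQ : 0 < Q) {a b : ℂ} (ha : |a.im| < π) (hb : |b.im| < π) (k : ℕ) :
    ContinuousOn (thetaCore p A Q a b k) (Ioi 0) := by
  have hmem : ∀ t : ℝ, 0 < t → (Q * (t * Complex.exp b) : ℂ) ∈ closedSector |b.im| := fun t ht => by
    have := pos_mul_exp_mem_closedSector (mul_pos hQ ht) (le_refl |b.im|)
    push_cast at this
    rwa [mul_assoc] at this
  refine ContinuousOn.mul (ContinuousOn.div (ContinuousOn.div (by fun_prop) (by fun_prop) ?_)
    ((continuousOn_thetaFn hp0 hp1).comp (by fun_prop) ?_) ?_) (by fun_prop)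
  · intro t ht
    have := one_add_ne_zero_of_mem_closedSector ha
      (pos_mul_exp_mem_closedSector (mul_pos (mul_pos hA ht) (pow_pos hp0 k)) le_rfl)
    push_cast at this
    convert this using 1
    ring
  · exact fun t ht => ne_zero_of_mem_closedSector (hmem t ht)
  · exact fun t ht => thetaFn_ne_zero_of_mem_closedSector hp0 hp1 hb (hmem t ht)

lemma integrableOn_tsum_thetaCore {p : ℝ} (hp0 : 0 < p) (hp1 : p < 1) {A Q : ℝ} (hA : 0 < A)
    (hQ : 0 < Q) {a b : ℂ} (ha : |a.im| < π) (hb : |b.im| < π) :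
    IntegrableOn (fun t => ∑' k, thetaCore p A Q a b k t) (Ioi 0) := by
  obtain ⟨M, ε, hε, h⟩ := exists_thetaCore_bound hp0 hp1 hA hQ ha hb
  have hW := summable_weight hp0 hp1
  refine integrableOn_of_norm_le_lorentz (M := (∑' k : ℕ,
    ‖eulerProd p (-p) * ((p : ℂ) ^ k / (qPoch p k : ℂ))‖) * M) (ε := ε) ?_ hε fun t ht => ?_
  · refine continuousOn_tsum (continuousOn_thetaCore hp0 hp1 hA hQ ha hb)
      (hW.mul_right |M|) fun k t ht => (h k t ht).trans ?_
    refine mul_le_mul_of_nonneg_left ?_ (norm_nonneg _)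
    refine (mul_le_mul_of_nonneg_right (le_abs_self M) (by positivity)).trans ?_
    refine mul_le_of_le_one_right (abs_nonneg M) (inv_le_one_of_one_le₀ ?_)
    nlinarith [sq_nonneg (ε * t)]
  · refine (tsum_of_norm_bounded (hW.mul_right (M * (1 + (ε * t) ^ 2)⁻¹)).hasSum
      fun k => h k t ht).trans_eq ?_
    rw [tsum_mul_right, mul_assoc]

/-- The Laplace transforms with kernels `θ_p` and `e_q` agree. -/
lemma integral_tsum_thetaCore {p : ℝ} (hp0 : 0 < p) (hp1 : p < 1) {A Q : ℝ} (hA : 0 < A)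
    (hQ : 0 < Q) {a b : ℂ} (ha : |a.im| < π) (hb : |b.im| < π) :
    ∫ t in Ioi (0 : ℝ), ∑' k, thetaCore p A Q a b k t =
      (A : ℂ)⁻¹ * expLaplace p (Q * A⁻¹) a b := by
  obtain ⟨M, ε, hε, h⟩ := exists_thetaCore_bound hp0 hp1 hA hQ ha hb
  have hint : ∀ k, IntegrableOn (thetaCore p A Q a b k) (Ioi 0) := fun k =>
    integrableOn_of_norm_le_lorentz (continuousOn_thetaCore hp0 hp1 hA hQ ha hb k) hε
      fun t ht => (h k t ht).trans_eq (mul_assoc _ _ _).symm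
  have hsum : Summable fun k => ∫ t in Ioi (0 : ℝ), ‖thetaCore p A Q a b k t‖ := by
    refine ((summable_weight hp0 hp1).mul_right
      (∫ t in Ioi (0 : ℝ), M * (1 + (ε * t) ^ 2)⁻¹)).of_nonneg_of_le
      (fun k => integral_nonneg fun t => norm_nonneg _) fun k => ?_
    rw [← integral_const_mul]
    exact setIntegral_mono_on (hint k).norm ((integrableOn_lorentz M hε).const_mul _)
      measurableSet_Ioi (h k)
  rw [integral_tsum_rescale (c := fun k => (A * p ^ k)⁻¹) (fun k => by positivity) hint hsum,
    expLaplace, ← integral_const_mul]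
  refine setIntegral_congr_fun measurableSet_Ioi fun t ht => ?_
  have hy : ((Q * A⁻¹ : ℝ) : ℂ) * t * Complex.exp b ∈ closedSector |b.im| := by
    have := pos_mul_exp_mem_closedSector (mul_pos (mul_pos hQ (inv_pos.2 hA)) ht) (le_refl |b.im|)
    rwa [Complex.ofReal_mul] at this
  have hP := eulerProd_ne_zero_of_mem_closedSector hp0 hp1 hb
    (pos_mul_mem_closedSector hp0 (inv_mem_closedSector hy))
  rw [← div_eq_mul_inv] at hP
  simp only [rescale_thetaCore hp0 hA]
  rw [tsum_mul_left, (hasSum_inv_thetaFn hp0 hp1 (ne_zero_of_mem_closedSector hy) hP).tsum_eq,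
    expCore]
  ring

/-! ### Equality of the two Jackson integrals. -/

/-- At the inner end of the spiral the norms tend to 1. At the outer end, 1 + p^(-n) y = p^(-n) (p^n
+ y), whose second factor tends to y. -/
lemma exists_le_norm_one_add_zpow {p : ℝ} (hp0 : 0 < p) (hp1 : p < 1) {y : ℂ} (hy : y ≠ 0)
    (h : ∀ n : ℤ, 1 + (p : ℂ) ^ n * y ≠ 0) : ∃ c > 0, ∀ n : ℤ, c ≤ ‖1 + (p : ℂ) ^ n * y‖ := by
  have hp : (p : ℂ) ≠ 0 := Complex.ofReal_ne_zero.2 hp0.ne'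
  have ht1 : Tendsto (fun n : ℕ => ‖1 + (p : ℂ) ^ n * y‖) atTop (𝓝 1) := by
    simpa using ((tendsto_pow_mul_zero hp0 hp1 y).const_add 1).norm
  have ht2 : Tendsto (fun n : ℕ => ‖(p : ℂ) ^ n * 1 + y‖) atTop (𝓝 ‖y‖) := by
    simpa using ((tendsto_pow_mul_zero hp0 hp1 1).add_const y).norm
  have e : ∀ n : ℕ, 1 + (p : ℂ) ^ (-(n : ℤ)) * y = ((p : ℂ) ^ n)⁻¹ * ((p : ℂ) ^ n * 1 + y) := by
    intro n
    rw [zpow_neg, zpow_natCast]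
    field_simp
  obtain ⟨c₁, hc₁, h₁⟩ := exists_pos_le_of_tendsto one_pos ht1 fun n =>
    norm_pos_iff.2 (by exact_mod_cast h n)
  obtain ⟨c₂, hc₂, h₂⟩ := exists_pos_le_of_tendsto (norm_pos_iff.2 hy) ht2 fun n =>
    norm_pos_iff.2 (right_ne_zero_of_mul ((e n) ▸ h (-(n : ℤ))))
  refine ⟨min c₁ c₂, lt_min hc₁ hc₂, fun n => ?_⟩
  obtain ⟨k, rfl | rfl⟩ := n.eq_nat_or_neg
  · exact (min_le_left _ _).trans (by exact_mod_cast h₁ k)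
  · refine (min_le_right _ _).trans ((h₂ k).trans ?_)
    rw [e, norm_mul, norm_inv, norm_pow, Complex.norm_of_nonneg hp0.le]
    exact le_mul_of_one_le_left (norm_nonneg _)
      ((one_le_inv₀ (pow_pos hp0 k)).2 (pow_le_one₀ hp0.le hp1.le))

lemma one_add_zpow_mul_inv_ne_zero {p : ℝ} (hp0 : 0 < p) {y : ℂ} (hy : y ≠ 0)
    (h : ∀ n : ℤ, 1 + (p : ℂ) ^ n * y ≠ 0) (n : ℤ) : 1 + (p : ℂ) ^ n * y⁻¹ ≠ 0 := by
  have hp : (p : ℂ) ^ n ≠ 0 := zpow_ne_zero _ (Complex.ofReal_ne_zero.2 hp0.ne')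
  have e : 1 + (p : ℂ) ^ n * y⁻¹ = (p : ℂ) ^ n * y⁻¹ * (1 + (p : ℂ) ^ (-n) * y) := by
    rw [zpow_neg]
    field_simp
    ring
  rw [e]
  exact mul_ne_zero (mul_ne_zero hp (inv_ne_zero hy)) (h _)

lemma thetaFn_lower_bound_zpow {p : ℝ} (hp0 : 0 < p) (hp1 : p < 1) {y : ℂ} (hy : y ≠ 0)
    (h : ∀ n : ℤ, 1 + (p : ℂ) ^ n * y ≠ 0) :
    ∃ m > 0, ∀ n : ℤ, m * (1 + ‖(p : ℂ) ^ n * y‖ ^ 2) ≤ ‖thetaFn p (p ^ n * y)‖ := by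
  have hp : (p : ℂ) ≠ 0 := Complex.ofReal_ne_zero.2 hp0.ne'
  obtain ⟨c₁, hc₁, h₁⟩ := exists_le_norm_one_add_zpow hp0 hp1 hy h
  obtain ⟨c₂, hc₂, h₂⟩ := exists_le_norm_one_add_zpow hp0 hp1 (inv_ne_zero hy)
    (one_add_zpow_mul_inv_ne_zero hp0 hy h)
  -- The theta bound needs a set stable under inversion, hence the spirals of both y and 1/y.
  set S := range (fun n : ℤ => (p : ℂ) ^ n * y) ∪ range fun n : ℤ => (p : ℂ) ^ n * y⁻¹
  have hSp : ∀ w ∈ S, (p : ℂ) * w ∈ S := by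
    rintro _ (⟨n, rfl⟩ | ⟨n, rfl⟩)
    · exact Or.inl ⟨n + 1, by simp only [zpow_add_one₀ hp]; ring⟩
    · exact Or.inr ⟨n + 1, by simp only [zpow_add_one₀ hp]; ring⟩
  have hSinv : ∀ w ∈ S, w⁻¹ ∈ S := by
    rintro _ (⟨n, rfl⟩ | ⟨n, rfl⟩)
    · exact Or.inr ⟨-n, by simp only [mul_inv, zpow_neg]⟩
    · exact Or.inl ⟨-n, by simp only [mul_inv, zpow_neg, inv_inv]⟩
  have hS0 : ∀ w ∈ S, w ≠ 0 := by
    rintro _ (⟨n, rfl⟩ | ⟨n, rfl⟩)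
    · exact mul_ne_zero (zpow_ne_zero _ hp) hy
    · exact mul_ne_zero (zpow_ne_zero _ hp) (inv_ne_zero hy)
  have hSc : ∀ w ∈ S, min c₁ c₂ ≤ ‖1 + w‖ := by
    rintro _ (⟨n, rfl⟩ | ⟨n, rfl⟩)
    · exact (min_le_left _ _).trans (h₁ n)
    · exact (min_le_right _ _).trans (h₂ n)
  obtain ⟨m, hm, hθ⟩ := exists_thetaFn_lower_bound hp0 hp1 hSp hSinv hS0 (lt_min hc₁ hc₂) hSc
  exact ⟨m, hm, fun n => hθ _ (Or.inl ⟨n, rfl⟩)⟩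

lemma summable_zpow_div {p : ℝ} (hp0 : 0 < p) (hp1 : p < 1) {r : ℝ} (hr : 0 < r) :
    Summable fun n : ℤ => p ^ n / (1 + (p ^ n * r) ^ 2) := by
  have hg := summable_geometric_of_lt_one hp0.le hp1
  refine Summable.of_nat_of_neg ?_ ?_
  · refine hg.of_nonneg_of_le (fun n => by positivity) fun n => ?_
    rw [zpow_natCast]
    exact div_le_self (by positivity) (by nlinarith [sq_nonneg (p ^ n * r)])
  · refine (hg.div_const (r ^ 2)).of_nonneg_of_le (fun n => by positivity) fun n => ?_
    rw [zpow_neg, zpow_natCast, div_le_div_iff₀ (by positivity) (by positivity)]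
    have hpn : 0 < p ^ n := pow_pos hp0 n
    have e : p ^ n * (1 + ((p ^ n)⁻¹ * r) ^ 2) = p ^ n + (p ^ n)⁻¹ * r ^ 2 := by
      field_simp
    rw [e]
    linarith

/-- The Jackson integrals with kernels `θ_p` and `e_q` converge and agree. -/
lemma jackson_sums {p : ℝ} (hp0 : 0 < p) (hp1 : p < 1) {a y : ℂ} (ha : a ≠ 0) (hy : y ≠ 0)
    (ha1 : ∀ n : ℤ, 1 + (p : ℂ) ^ n * a ≠ 0) (hy1 : ∀ n : ℤ, 1 + (p : ℂ) ^ n * y ≠ 0) :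
    (Summable fun n : ℤ => 1 / (1 + (p : ℂ) ^ n * a) / eulerProd p (p ^ n * y) * (p : ℂ) ^ n) ∧
    (Summable fun n : ℤ => mittagLeffler p (-(p ^ n * a)) / thetaFn p (p ^ n * y) * (p : ℂ) ^ n) ∧
    ∑' n : ℤ, 1 / (1 + (p : ℂ) ^ n * a) / eulerProd p (p ^ n * y) * (p : ℂ) ^ n =
      ∑' n : ℤ, mittagLeffler p (-(p ^ n * a)) / thetaFn p (p ^ n * y) * (p : ℂ) ^ n := by
  have hp : (p : ℂ) ≠ 0 := Complex.ofReal_ne_zero.2 hp0.ne'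
  have hpn := Complex.norm_of_nonneg hp0.le
  obtain ⟨c, hc, hca⟩ := exists_le_norm_one_add_zpow hp0 hp1 ha ha1
  obtain ⟨m, hm, hθ⟩ := thetaFn_lower_bound_zpow hp0 hp1 hy hy1
  -- Summed over k at fixed n, B gives the theta side; after the shear n ↦ n - k, which plays the
  -- role of the rescaling, it gives the e_q side.
  obtain ⟨B, hB⟩ : ∃ B : ℤ × ℕ → ℂ, ∀ b, B b =
      eulerProd p (-p) * ((p : ℂ) ^ b.2 / (qPoch p b.2 : ℂ)) / (1 - -(p ^ b.1 * a) * p ^ b.2) *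
        ((thetaFn p (p ^ b.1 * y))⁻¹ * (p : ℂ) ^ b.1) := ⟨_, fun _ => rfl⟩
  have hsum : Summable B := by
    have hg := (((summable_zpow_div hp0 hp1 (norm_pos_iff.2 hy)).div_const m).mul_of_nonneg
      ((summable_weight hp0 hp1).div_const c) (fun n => by positivity) fun k => by positivity)
    refine Summable.of_norm_bounded hg fun b => ?_
    have e : (1 : ℂ) - -(p ^ b.1 * a) * p ^ b.2 = 1 + (p : ℂ) ^ (b.1 + b.2 : ℤ) * a := by
      rw [zpow_add₀ hp, zpow_natCast]
      ring
    have h1 := hca (b.1 + b.2)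
    have h2 := hθ b.1
    rw [norm_mul, norm_zpow, hpn] at h2
    rw [hB, norm_mul, norm_div, e, norm_mul (thetaFn p (p ^ b.1 * y))⁻¹, norm_inv, norm_zpow, hpn,
      inv_mul_eq_div, mul_comm, div_div _ _ m, mul_comm _ m]
    gcongr
  have hrow : ∀ n : ℤ, ∑' k, B (n, k) =
      mittagLeffler p (-(p ^ n * a)) / thetaFn p (p ^ n * y) * (p : ℂ) ^ n := fun n => by
    simp only [hB]
    rw [tsum_mul_right, mittagLeffler, div_eq_mul_inv, mul_assoc]
  have hsh : Summable fun b => B (shearEquiv b) := shearEquiv.summable_iff.2 hsum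
  have hcol : ∀ n : ℤ, ∑' k, B (shearEquiv (n, k)) =
      1 / (1 + (p : ℂ) ^ n * a) / eulerProd p (p ^ n * y) * (p : ℂ) ^ n := fun n => by
    have hyn : (p : ℂ) ^ n * y ≠ 0 := mul_ne_zero (zpow_ne_zero _ hp) hy
    have hP : eulerProd p (p / (p ^ n * y)) ≠ 0 := by
      refine eulerProd_ne_zero hp0 hp1 fun k => ?_
      convert one_add_zpow_mul_inv_ne_zero hp0 hy hy1 (k + 1 - n) using 2
      rw [zpow_sub₀ hp, zpow_add_one₀ hp, zpow_natCast]
      field_simp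
    have h := ((hasSum_inv_thetaFn hp0 hp1 hyn hP).mul_left
      ((p : ℂ) ^ n / (1 + (p : ℂ) ^ n * a))).tsum_eq
    have e : 1 / (1 + (p : ℂ) ^ n * a) / eulerProd p (p ^ n * y) * (p : ℂ) ^ n =
      (p : ℂ) ^ n / (1 + (p : ℂ) ^ n * a) * (1 / eulerProd p (p ^ n * y)) := by ring
    rw [e, ← h]
    refine tsum_congr fun k => ?_
    have hpk : (p : ℂ) ^ k ≠ 0 := pow_ne_zero k hp
    simp only [hB, shearEquiv, Equiv.coe_fn_mk]
    have e1 : (1 : ℂ) - -(p ^ (n - k : ℤ) * a) * p ^ k = 1 + (p : ℂ) ^ n * a := by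
      rw [zpow_sub₀ hp, zpow_natCast]
      field_simp
      ring
    have e2 : (p : ℂ) ^ (n - k : ℤ) * y = p ^ n * y / p ^ k := by
      rw [zpow_sub₀ hp, zpow_natCast]
      ring
    rw [e1, e2, zpow_sub₀ hp, zpow_natCast]
    generalize thetaFn p _ = T
    generalize (1 : ℂ) + (p : ℂ) ^ n * a = D
    field_simp
  refine ⟨?_, ?_, ?_⟩
  · simpa only [hcol] using hsh.prod
  · simpa only [hrow] using hsum.prod
  · simp only [← hcol, ← hrow]
    rw [← hsh.tsum_prod, ← hsum.tsum_prod]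
    exact shearEquiv.tsum_eq B

/-! ### Identification with the transforms of the theorem, and the continuation. -/

/-- The constant q (1-p) is kept as `q * (1 - q⁻¹)⁻¹⁻¹` to match `Q * A⁻¹` in
`integral_tsum_thetaCore` with A = 1/(1-p). -/
lemma ray_kernel_exp {q : ℝ} (hq : 1 < q) {ψ : ℂ → ℂ} (hψ : EqOn ψ (fun ξ => 1 / (1 + ξ)) {-1}ᶜ)
    {d t : ℝ} (hd : |d| < π) (ht : 0 < t) (z : ℂ) :
    rayIntegrand d (expKernel q ψ (Complex.exp z)) t =
      expCore q⁻¹ (q * (1 - q⁻¹)⁻¹⁻¹) (d * Complex.I) (d * Complex.I - z) t := by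
  have h1 : 1 + (t : ℂ) * Complex.exp (d * Complex.I) ≠ 0 :=
    one_add_ne_zero_of_mem_closedSector hd (pos_mul_exp_mem_closedSector ht (by simp))
  have h2 : (t : ℂ) * Complex.exp (d * Complex.I) ∈ ({-1}ᶜ : Set ℂ) := fun h => h1 (by
    rw [mem_singleton_iff.1 h, add_neg_cancel])
  rw [rayIntegrand, expKernel, expCore, hψ h2, qExp_eq_eulerProd hq, Complex.exp_sub]
  push_cast
  rw [inv_inv]
  ring_nf

lemma ray_kernel_theta {q : ℝ} (hq : 1 < q) {φ : ℂ → ℂ}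
    (hφ : EqOn φ (borelSum q) (borelDomain q)) {d t : ℝ} (hd : |d| < π) (ht : 0 < t) (z : ℂ) :
    rayIntegrand d (thetaKernel q φ (Complex.exp z)) t =
      ∑' k, thetaCore q⁻¹ (1 - q⁻¹)⁻¹ q (d * Complex.I) (d * Complex.I - z) k t := by
  have hA := inv_pos.2 (one_sub_inv_pos hq)
  have hp0 : 0 < q⁻¹ := inv_pos.2 (zero_lt_one.trans hq)
  have hmem : (t : ℂ) * Complex.exp (d * Complex.I) ∈ borelDomain q := by
    rw [borelDomain_iff hq]
    intro k
    have h := one_add_ne_zero_of_mem_closedSector hd (pos_mul_exp_mem_closedSector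
      (w := d * Complex.I) (mul_pos (mul_pos hA ht) (pow_pos hp0 k)) (by simp))
    convert h using 1
    push_cast
    ring
  rw [rayIntegrand, thetaKernel, hφ hmem, borelSum, mittagLeffler]
  simp only [thetaCore]
  rw [tsum_mul_right, tsum_div_const, Complex.exp_sub]
  push_cast
  rw [← mul_div_assoc (t : ℂ)]

lemma abs_im_ray {d : ℝ} (z : ℂ) (hdz : |z.im - d| < π) : |(d * Complex.I - z : ℂ).im| < π := by
  rw [abs_sub_comm] at hdz
  simpa using hdz

lemma abs_im_mul_I {d : ℝ} (hd : |d| < π) : |(d * Complex.I : ℂ).im| < π := by simpa using hd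

lemma laplaceExp_eq {q : ℝ} (hq : 1 < q) {ψ : ℂ → ℂ} (hψ : EqOn ψ (fun ξ => 1 / (1 + ξ)) {-1}ᶜ)
    {d : ℝ} (hd : |d| < π) (z : ℂ) : laplaceExp q ψ d (Complex.exp z) =
      ((q - 1) / Real.log q : ℝ) *
        expLaplace q⁻¹ (q * (1 - q⁻¹)⁻¹⁻¹) (d * Complex.I) (d * Complex.I - z) := by
  rw [laplaceExp, rayIntegral, expLaplace]
  congr 1
  exact setIntegral_congr_fun measurableSet_Ioi fun t ht => ray_kernel_exp hq hψ hd ht z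

lemma laplaceTheta_eq {q : ℝ} (hq : 1 < q) {φ : ℂ → ℂ}
    (hφ : EqOn φ (borelSum q) (borelDomain q)) {d : ℝ} (hd : |d| < π) {z : ℂ}
    (hdz : |z.im - d| < π) : laplaceTheta q φ d (Complex.exp z) =
      ((q - 1) / Real.log q : ℝ) *
        expLaplace q⁻¹ (q * (1 - q⁻¹)⁻¹⁻¹) (d * Complex.I) (d * Complex.I - z) := by
  have h0 : (q : ℂ) ≠ 0 := by exact_mod_cast (zero_lt_one.trans hq).ne'
  have h1 : rayIntegral d (thetaKernel q φ (Complex.exp z)) = _ :=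
    setIntegral_congr_fun measurableSet_Ioi fun t ht => ray_kernel_theta hq hφ hd ht z
  rw [laplaceTheta, h1, integral_tsum_thetaCore (inv_pos.2 (zero_lt_one.trans hq))
    (inv_lt_one_of_one_lt₀ hq) (inv_pos.2 (one_sub_inv_pos hq)) (zero_lt_one.trans hq)
    (abs_im_mul_I hd) (abs_im_ray z hdz), ← mul_assoc]
  congr 1
  push_cast
  rw [inv_inv]
  field_simp

/-- The sum of the `q`-Euler series on the sector `|arg x| < 2π`, in the coordinate `log x`. -/
def qEulerSum (q : ℝ) (z : ℂ) : ℂ :=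
  ((q - 1) / Real.log q : ℝ) * expLaplace q⁻¹ (q * (1 - q⁻¹)⁻¹⁻¹) (z / 2) (z / 2 - z)

/-- A fixed direction d only covers |arg x - d| < π. The direction w = z/2, holomorphic in z, splits
the argument evenly between w and w - z and is admissible on the whole sector. -/
lemma abs_im_half {z : ℂ} (hz : z ∈ logSector) : |(z / 2).im| < π ∧ |(z / 2 - z).im| < π := by
  have hz' : |z.im| < 2 * π := hz
  have e1 : (z / 2).im = z.im / 2 := by simp
  rw [abs_lt] at hz'
  rw [Complex.sub_im, e1, abs_lt, abs_lt]
  refine ⟨⟨?_, ?_⟩, ?_, ?_⟩ <;> linarith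

lemma differentiableOn_qEulerSum {q : ℝ} (hq : 1 < q) :
    DifferentiableOn ℂ (qEulerSum q) logSector := by
  have hC : 0 < q * (1 - q⁻¹)⁻¹⁻¹ :=
    mul_pos (zero_lt_one.trans hq) (inv_pos.2 (inv_pos.2 (one_sub_inv_pos hq)))
  have h := differentiableOn_expLaplace (inv_pos.2 (zero_lt_one.trans hq))
    (inv_lt_one_of_one_lt₀ hq) hC (f := fun z => z / 2) (g := fun z => z / 2 - z)
    (by fun_prop) (by fun_prop)
  exact (h.mono fun z hz => abs_im_half hz).const_mul _

lemma mem_logSector {d : ℝ} (hd : |d| < π) {z : ℂ} (hdz : |z.im - d| < π) : z ∈ logSector := by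
  change |z.im| < 2 * π
  rw [abs_lt] at hd hdz ⊢
  constructor <;> linarith

lemma qEulerSum_eq {q : ℝ} (hq : 1 < q) {d : ℝ} (hd : |d| < π) {z : ℂ} (hdz : |z.im - d| < π) :
    qEulerSum q z = ((q - 1) / Real.log q : ℝ) *
      expLaplace q⁻¹ (q * (1 - q⁻¹)⁻¹⁻¹) (d * Complex.I) (d * Complex.I - z) := by
  have hC : 0 < q * (1 - q⁻¹)⁻¹⁻¹ :=
    mul_pos (zero_lt_one.trans hq) (inv_pos.2 (inv_pos.2 (one_sub_inv_pos hq)))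
  rw [qEulerSum, expLaplace_eq_of_direction (inv_pos.2 (zero_lt_one.trans hq))
    (inv_lt_one_of_one_lt₀ hq) hC (abs_im_half (mem_logSector hd hdz))
    ⟨abs_im_mul_I hd, abs_im_ray z hdz⟩]

lemma ContinuesFrom.eqOn {d : ℝ} (hd : |d| < π) {s F G : ℂ → ℂ} (hF : ContinuesFrom d s F)
    (hG : ContinuesFrom d s G) : EqOn F G logSector := by
  have hc : Continuous fun z : ℂ => |z.im| := by fun_prop
  have hc' : Continuous fun z : ℂ => |z.im - d| := by fun_prop
  have ho : IsOpen logSector := isOpen_lt hc continuous_const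
  have hconv : Convex ℝ logSector := by
    have e : logSector = Complex.im ⁻¹' Ioo (-(2 * π)) (2 * π) := by
      ext z
      change |z.im| < 2 * π ↔ -(2 * π) < z.im ∧ z.im < 2 * π
      exact abs_lt
    rw [e]
    exact (convex_Ioo _ _).is_linear_preimage Complex.imLm.isLinear
  have hz₀ : |(d * Complex.I : ℂ).im - d| < π := by simpa using Real.pi_pos
  refine (hF.1.analyticOnNhd ho).eqOn_of_preconnected_of_eventuallyEq (hG.1.analyticOnNhd ho)
    hconv.isPreconnected (mem_logSector hd hz₀) ?_
  filter_upwards [(isOpen_lt hc' continuous_const).mem_nhds hz₀] with z hz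
  rw [hF.2 z hz, hG.2 z hz]

lemma one_add_zpow_mul_ne_zero_of_pole {q : ℝ} (hq : 1 < q) {l : ℂ}
    (hl : ∀ n : ℤ, l ≠ -(1 - (q : ℂ)⁻¹) * (q : ℂ) ^ n) (n : ℤ) :
    1 + ((q⁻¹ : ℝ) : ℂ) ^ n * (l / (1 - (q : ℂ)⁻¹)) ≠ 0 := by
  have h0 : (q : ℂ) ^ n ≠ 0 := zpow_ne_zero _ (by exact_mod_cast (zero_lt_one.trans hq).ne')
  have h1 := one_sub_inv_ne_zero hq
  intro h
  apply hl n
  rw [Complex.ofReal_inv, inv_zpow] at h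
  generalize (1 - (q : ℂ)⁻¹) = t at h1 h ⊢
  field_simp at h
  linear_combination h

lemma one_add_zpow_mul_ne_zero_of_zero {q : ℝ} (hq : 1 < q) {l x : ℂ} (hx : x ≠ 0)
    (hlx : ∀ n : ℤ, x ≠ -l * (q : ℂ) ^ n) (n : ℤ) :
    1 + ((q⁻¹ : ℝ) : ℂ) ^ n * (q * l / x) ≠ 0 := by
  have hq0 : (q : ℂ) ≠ 0 := by exact_mod_cast (zero_lt_one.trans hq).ne'
  have h0 : (q : ℂ) ^ n ≠ 0 := zpow_ne_zero _ hq0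
  intro h
  -- The factor q in the argument of the kernel shifts the exponent by one.
  apply hlx (1 - n)
  rw [Complex.ofReal_inv, inv_zpow] at h
  rw [zpow_sub₀ hq0, zpow_one]
  field_simp at h ⊢
  linear_combination h

lemma discrete_kernels {q : ℝ} (hq : 1 < q) {ψ φ : ℂ → ℂ}
    (hψ : EqOn ψ (fun ξ => 1 / (1 + ξ)) {-1}ᶜ) (hφ : EqOn φ (borelSum q) (borelDomain q))
    {l : ℂ} (hl0 : l ≠ 0) (hl : ∀ n : ℤ, l ≠ -(1 - (q : ℂ)⁻¹) * (q : ℂ) ^ n) {x : ℂ} (hx : x ≠ 0)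
    (hlx : ∀ n : ℤ, x ≠ -l * (q : ℂ) ^ n) :
    JacksonSummable q⁻¹ l (expKernelDiscrete q ψ x) ∧
      JacksonSummable q⁻¹ l (thetaKernel q φ x) ∧
      laplaceExpDiscrete q ψ l x = laplaceThetaDiscrete q φ l x := by
  have hp0 : 0 < q⁻¹ := inv_pos.2 (zero_lt_one.trans hq)
  have hq0 : (q : ℂ) ≠ 0 := by exact_mod_cast (zero_lt_one.trans hq).ne'
  have h1 := one_sub_inv_ne_zero hq
  have hla := one_add_zpow_mul_ne_zero_of_pole hq hl
  have key := jackson_sums hp0 (inv_lt_one_of_one_lt₀ hq) (div_ne_zero hl0 h1)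
    (div_ne_zero (mul_ne_zero hq0 hl0) hx) hla (one_add_zpow_mul_ne_zero_of_zero hq hx hlx)
  have e1 : (fun n : ℤ => expKernelDiscrete q ψ x (((q⁻¹ : ℝ) : ℂ) ^ n * l) *
      ((q⁻¹ : ℝ) : ℂ) ^ n) = fun n : ℤ => 1 / (1 + ((q⁻¹ : ℝ) : ℂ) ^ n * (l / (1 - (q : ℂ)⁻¹))) /
        eulerProd q⁻¹ (((q⁻¹ : ℝ) : ℂ) ^ n * (q * l / x)) * ((q⁻¹ : ℝ) : ℂ) ^ n := by
    funext n
    have hmem : ((q⁻¹ : ℝ) : ℂ) ^ n * l / (1 - (q : ℂ)⁻¹) ∈ ({-1}ᶜ : Set ℂ) := fun h =>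
      hla n (by rw [← mul_div_assoc, mem_singleton_iff.1 h, add_neg_cancel])
    have e : (1 - (q : ℂ)⁻¹) * (q * (((q⁻¹ : ℝ) : ℂ) ^ n * l / ((1 - (q : ℂ)⁻¹) * x))) =
        ((q⁻¹ : ℝ) : ℂ) ^ n * (q * l / x) := by
      generalize (1 - (q : ℂ)⁻¹) = t at h1 ⊢
      field_simp
    rw [expKernelDiscrete, hψ hmem, qExp_eq_eulerProd hq, e, mul_div_assoc _ l]
  have e2 : (fun n : ℤ => thetaKernel q φ x (((q⁻¹ : ℝ) : ℂ) ^ n * l) * ((q⁻¹ : ℝ) : ℂ) ^ n) =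
      fun n : ℤ => mittagLeffler q⁻¹ (-(((q⁻¹ : ℝ) : ℂ) ^ n * (l / (1 - (q : ℂ)⁻¹)))) /
        thetaFn q⁻¹ (((q⁻¹ : ℝ) : ℂ) ^ n * (q * l / x)) * ((q⁻¹ : ℝ) : ℂ) ^ n := by
    funext n
    have hmem : ((q⁻¹ : ℝ) : ℂ) ^ n * l ∈ borelDomain q := by
      rw [borelDomain_iff hq]
      intro k
      convert hla (n + k) using 1
      rw [zpow_add₀ (Complex.ofReal_ne_zero.2 hp0.ne'), zpow_natCast]
      ring
    rw [thetaKernel, hφ hmem, borelSum]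
    ring_nf
  rw [laplaceExpDiscrete, laplaceThetaDiscrete, jacksonIntegral, jacksonIntegral, JacksonSummable,
    JacksonSummable, e1, e2]
  exact ⟨key.1, key.2.1, by rw [key.2.2]⟩

end

theorem mainTheorem4 (q : ℝ) (hq : 1 < q) :
    -- the two Borel transforms of the `q`-Euler series have analytic continuations
    IsContinuationOfSeries (formalBorelFact q (qEulerSeries q)) {-1}ᶜ (fun ξ => 1 / (1 + ξ)) ∧
    (∃ φ : ℂ → ℂ, IsContinuationOfSeries (formalBorelTheta q (qEulerSeries q))
      {ξ : ℂ | ∀ n : ℕ, ξ ≠ ((q : ℂ)⁻¹ - 1) * (q : ℂ) ^ n} φ) ∧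
    ∀ ψ φ : ℂ → ℂ,
      IsContinuationOfSeries (formalBorelFact q (qEulerSeries q)) {-1}ᶜ ψ →
      IsContinuationOfSeries (formalBorelTheta q (qEulerSeries q))
        {ξ : ℂ | ∀ n : ℕ, ξ ≠ ((q : ℂ)⁻¹ - 1) * (q : ℂ) ^ n} φ →
      -- the continuous sums: convergence, continuation to `|arg x| < 2π`, and coincidence
      ((∀ d ∈ Ioo (-π) π, ∀ z : ℂ, |z.im - d| < π →
          RayIntegrable d (expKernel q ψ (Complex.exp z)) ∧
          RayIntegrable d (thetaKernel q φ (Complex.exp z))) ∧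
        (∃ F : ℂ → ℂ, ∀ d ∈ Ioo (-π) π, ContinuesFrom d (laplaceExp q ψ d) F) ∧
        (∃ G : ℂ → ℂ, ∀ d ∈ Ioo (-π) π, ContinuesFrom d (laplaceTheta q φ d) G) ∧
        (∀ d ∈ Ioo (-π) π, ∀ d' ∈ Ioo (-π) π, ∀ F G : ℂ → ℂ,
          ContinuesFrom d (laplaceExp q ψ d) F →
          ContinuesFrom d' (laplaceTheta q φ d') G →
          ∀ z ∈ logSector, F z = G z)) ∧
      -- the discrete sums: convergence and coincidence off the spirals of poles
      (∀ l : ℂ, l ≠ 0 → (∀ n : ℤ, l ≠ -(1 - (q : ℂ)⁻¹) * (q : ℂ) ^ n) →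
        ∀ x : ℂ, x ≠ 0 → (∀ n : ℤ, x ≠ -l * (q : ℂ) ^ n) →
          JacksonSummable q⁻¹ l (expKernelDiscrete q ψ x) ∧
          JacksonSummable q⁻¹ l (thetaKernel q φ x) ∧
          laplaceExpDiscrete q ψ l x = laplaceThetaDiscrete q φ l x) := by 
  refine ⟨isContinuation_geometric hq, ⟨borelSum q, isContinuation_borelSum hq⟩,
    fun ψ φ hψ' hφ' => ?_⟩
  have hψ := eqOn_geometric hq hψ'
  have hφ := eqOn_borelSum hq hφ'
  have hp0 : 0 < q⁻¹ := inv_pos.2 (zero_lt_one.trans hq)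
  have hp1 : q⁻¹ < 1 := inv_lt_one_of_one_lt₀ hq
  have hA : 0 < (1 - q⁻¹)⁻¹ := inv_pos.2 (one_sub_inv_pos hq)
  have hC : 0 < q * (1 - q⁻¹)⁻¹⁻¹ := mul_pos (zero_lt_one.trans hq) (inv_pos.2 hA)
  have hF : ∀ d ∈ Ioo (-π) π, ContinuesFrom d (laplaceExp q ψ d) (qEulerSum q) := fun d hd =>
    ⟨differentiableOn_qEulerSum hq, fun z hz => by
      rw [laplaceExp_eq hq hψ (abs_lt.2 hd), qEulerSum_eq hq (abs_lt.2 hd) hz]⟩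
  have hG : ∀ d ∈ Ioo (-π) π, ContinuesFrom d (laplaceTheta q φ d) (qEulerSum q) := fun d hd =>
    ⟨differentiableOn_qEulerSum hq, fun z hz => by
      rw [laplaceTheta_eq hq hφ (abs_lt.2 hd) hz, qEulerSum_eq hq (abs_lt.2 hd) hz]⟩
  refine ⟨⟨fun d hd z hz => ⟨?_, ?_⟩, ⟨_, hF⟩, ⟨_, hG⟩, fun d hd d' hd' F G hFd hGd z hz => ?_⟩,
    fun l hl0 hl x hx hlx => discrete_kernels hq hψ hφ hl0 hl hx hlx⟩
  · exact (integrableOn_expCore hp0 hp1 hC (abs_im_mul_I (abs_lt.2 hd)) (abs_im_ray z hz)).congr_fun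
      (fun t ht => (ray_kernel_exp hq hψ (abs_lt.2 hd) ht z).symm) measurableSet_Ioi
  · exact (integrableOn_tsum_thetaCore hp0 hp1 hA (zero_lt_one.trans hq)
      (abs_im_mul_I (abs_lt.2 hd)) (abs_im_ray z hz)).congr_fun
      (fun t ht => (ray_kernel_theta hq hφ (abs_lt.2 hd) ht z).symm) measurableSet_Ioi
  · rw [hFd.eqOn (abs_lt.2 hd) (hF d hd) hz, hGd.eqOn (abs_lt.2 hd') (hG d' hd') hz]
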